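/- **Theorem.** Let $\Omega\subset\mathbb R$ be an open interval, possibly unbounded. Let $A:[0,\infty)\to[0,\infty]$ be a non-degenerate Young function, i.e. $A$ is convex, left-continuous, non-constant on $(0,\infty)$, $A(0)=0$, and $A(t)>0$ for $t>0$. Let $f:\mathbb R\to\mathbb R$ be locally Lipschitz continuous and put $T_f u=f(u)=f\circ u$. For an open set $G\subset\mathbb R$, $L^A(G)$ is the set of measurable $u:G\to\mathbb R$ such that $\int_G A(|u|/\lambda)\,dx<\infty$ for some $\lambda>0$, and $$W^{1,A}(G)=\{u\in L^A(G): u \text{ is weakly differentiable and } u'\in L^A(G)\}.$$ Moreover, $V^{1,A}_0(\Omega)$ is the set of measurable $u:\Omega\to\mathbb R$ whose extension by zero $\widehat u:\mathbb R\to\mathbb R$ satisfies $\widehat u\in W^{1,1}_{\rm loc}(\mathbb R)$, $\widehat u\,'\in L^A(\mathbb R)$, and $|\{x\in\mathbb R:|\widehat u(x)|>t\}|<\infty$ for every $t>0$. A sequence $u_k\in W^{1,A}(\Omega)$ converges modularly in $W^{1,A}(\Omega)$ to $u\in W^{1,A}(\Omega)$ if, for some $\lambda>0$, $$\int_\Omega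 A\Big(\frac{|u_k-u|}{\lambda}\Big)dx\to0\quad\text{and}\quad \int_\Omega A\Big(\frac{|u_k'-u'|}{\lambda}\Big)dx\to0 \qquad (k\to\infty);$$ in $V^{1,A}_0(\Omega)$, only the second limit is required (for some $\lambda>0$), for $u_k,u\in V^{1,A}_0(\Omega)$. The operator $T_f$ is called modularly continuous on one of these spaces if it maps the space into itself and $T_fu_k\to T_fu$ modularly in the space whenever $u_k\to u$ modularly in the space. Finally, $A(t)\simeq t$ near zero means that there are $c,t_0>0$ such that $A(t/c)\le t\le A(ct)$ for $0\le t\le t_0$. 1. If $\Omega$ is bounded, or if $f(0)=0$, then $T_f$ is modularly continuous on $W^{1,A}(\Omega)$. 2. Assume $f(0)=0$. If $\Omega$ is bounded, or if $A(t)\simeq t$ near zero, then $T_f$ is modularly continuous on $V^{1,A}_0(\Omega)$. -/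

import Mathlib

open MeasureTheory Set Filter Topology
open scoped NNReal ENNReal ContDiff

namespace OrliczSobolev

/-- A Young function `A : [0, ∞) → [0, ∞]`. -/
structure IsYoung (A : ℝ≥0 → ℝ≥0∞) : Prop where
  convex : ConvexOn ℝ≥0 univ A
  leftCont : ∀ t, ContinuousWithinAt A (Iic t) t
  zero : A 0 = 0
  nonconst : ∃ s t, 0 < s ∧ 0 < t ∧ A s ≠ A t

/-- Non-degeneracy: `A t > 0` for `t > 0`. -/
def IsNondegenerate (A : ℝ≥0 → ℝ≥0∞) : Prop := ∀ t, 0 < t → 0 < A t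

/-- `A ≃ B` near zero. -/
def EquivNearZero (A B : ℝ≥0 → ℝ≥0∞) : Prop :=
  ∃ c : ℝ≥0, 0 < c ∧ ∃ t₀ : ℝ≥0, 0 < t₀ ∧
    ∀ t : ℝ≥0, t ≤ t₀ → A (t / c) ≤ B t ∧ B t ≤ A (c * t)

/-- The integral `∫_Ω A(|u(x)| / l) dx`. -/
noncomputable def modular (A : ℝ≥0 → ℝ≥0∞) (Ω : Set ℝ) (l : ℝ≥0) (u : ℝ → ℝ) : ℝ≥0∞ :=
  ∫⁻ x in Ω, A (‖u x‖₊ / l)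

/-- The Orlicz space `L^A(Ω)`. Functions on `Ω` are represented by functions on `ℝ` whose values
outside `Ω` are never used. -/
def OrliczSpace (A : ℝ≥0 → ℝ≥0∞) (Ω : Set ℝ) : Set (ℝ → ℝ) :=
  {u | AEMeasurable u (volume.restrict Ω) ∧ ∃ l : ℝ≥0, 0 < l ∧ modular A Ω l u < ⊤}

/-- `v` is a weak derivative of `u` on the open set `Ω`. -/
structure IsWeakDeriv (Ω : Set ℝ) (u v : ℝ → ℝ) : Prop where
  locInt : LocallyIntegrableOn u Ω volume
  locInt_deriv : LocallyIntegrableOn v Ω volume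
  integral_eq : ∀ φ : ℝ → ℝ, ContDiff ℝ ∞ φ → HasCompactSupport φ → tsupport φ ⊆ Ω →
    ∫ x in Ω, u x * deriv φ x = -∫ x in Ω, v x * φ x

/-- Weak derivatives are unique almost everywhere, so the existential quantifiers over weak
derivatives below do not depend on a choice. -/
theorem IsWeakDeriv.ae_unique {Ω : Set ℝ} (hΩ : IsOpen Ω) {u v w : ℝ → ℝ}
    (hv : IsWeakDeriv Ω u v) (hw : IsWeakDeriv Ω u w) :
    ∀ᵐ x ∂(volume.restrict Ω), v x = w x := by
  have key := hΩ.ae_eq_zero_of_integral_contDiff_smul_eq_zero (μ := volume)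
    (hv.locInt_deriv.sub hw.locInt_deriv) (by
      intro φ hφ hc hs
      have h1 := hv.integral_eq φ hφ hc hs
      have h2 := hw.integral_eq φ hφ hc hs
      have hint : ∀ g : ℝ → ℝ, LocallyIntegrableOn g Ω volume →
          Integrable (fun x => φ x * g x) volume := by
        intro g hg
        have hgK : IntegrableOn g (tsupport φ) volume :=
          hg.integrableOn_compact_subset hs hc
        have h3 : IntegrableOn (fun x => φ x * g x) (tsupport φ) volume :=
          hgK.continuousOn_mul hφ.continuous.continuousOn hc
        refine (integrableOn_iff_integrable_of_support_subset ?_).1 h3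
        intro x hx
        apply subset_tsupport φ
        intro h0
        exact hx (by simp [h0])
      have hres : ∀ g : ℝ → ℝ, ∫ x in Ω, g x * φ x = ∫ x, φ x * g x := by
        intro g
        rw [setIntegral_eq_integral_of_forall_compl_eq_zero]
        · simp only [mul_comm]
        · intro x hx
          rw [image_eq_zero_of_notMem_tsupport (fun h => hx (hs h)), mul_zero]
      rw [hres] at h1 h2
      simp only [smul_eq_mul, Pi.sub_apply, mul_sub]
      rw [integral_sub (hint v hv.locInt_deriv) (hint w hw.locInt_deriv)]
      linarith)
  rw [ae_restrict_iff' hΩ.measurableSet]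
  filter_upwards [key] with x hx hxΩ
  have := hx hxΩ
  simp only [Pi.sub_apply] at this
  linarith

/-- The Orlicz-Sobolev space `W^{1,A}(Ω)`. -/
def W1 (A : ℝ≥0 → ℝ≥0∞) (Ω : Set ℝ) : Set (ℝ → ℝ) :=
  {u | u ∈ OrliczSpace A Ω ∧ ∃ v, IsWeakDeriv Ω u v ∧ v ∈ OrliczSpace A Ω}

/-- The space `V^{1,A}_0(Ω)`: the extension of `u` by zero belongs to `W^{1,1}_loc(ℝ)`, its weak
derivative belongs to `L^A(ℝ)`, and its super-level sets have finite measure. -/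
def V10 (A : ℝ≥0 → ℝ≥0∞) (Ω : Set ℝ) : Set (ℝ → ℝ) :=
  {u | AEMeasurable u (volume.restrict Ω) ∧
    (∃ v, IsWeakDeriv univ (Ω.indicator u) v ∧ v ∈ OrliczSpace A univ) ∧
    ∀ t : ℝ, 0 < t → volume {x | t < |Ω.indicator u x|} < ⊤}

/-- Modular convergence in `L^A(Ω)` with constant `l`. -/
def ModularTendstoWith (A : ℝ≥0 → ℝ≥0∞) (Ω : Set ℝ) (l : ℝ≥0) (u : ℕ → ℝ → ℝ) (u₀ : ℝ → ℝ) :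
    Prop :=
  Tendsto (fun k => modular A Ω l (fun x => u k x - u₀ x)) atTop (𝓝 0)

/-- Modular convergence in `W^{1,A}(Ω)`: functions and weak derivatives converge modularly. -/
def W1ModularTendsto (A : ℝ≥0 → ℝ≥0∞) (Ω : Set ℝ) (u : ℕ → ℝ → ℝ) (u₀ : ℝ → ℝ) : Prop :=
  ∃ (v : ℕ → ℝ → ℝ) (v₀ : ℝ → ℝ),
    (∀ k, IsWeakDeriv Ω (u k) (v k)) ∧ IsWeakDeriv Ω u₀ v₀ ∧
    ∃ l : ℝ≥0, 0 < l ∧ ModularTendstoWith A Ω l u u₀ ∧ ModularTendstoWith A Ω l v v₀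

/-- Modular convergence in `V^{1,A}_0(Ω)`: the weak derivatives converge modularly. -/
def V10ModularTendsto (A : ℝ≥0 → ℝ≥0∞) (Ω : Set ℝ) (u : ℕ → ℝ → ℝ) (u₀ : ℝ → ℝ) : Prop :=
  ∃ (v : ℕ → ℝ → ℝ) (v₀ : ℝ → ℝ),
    (∀ k, IsWeakDeriv univ (Ω.indicator (u k)) (v k)) ∧ IsWeakDeriv univ (Ω.indicator u₀) v₀ ∧
    ∃ l : ℝ≥0, 0 < l ∧ ModularTendstoWith A Ω l v v₀

/-- `T` maps `S` into itself and sends convergent sequences in `S` to convergent sequences. -/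
def IsModularlyContinuous (S : Set (ℝ → ℝ)) (conv : (ℕ → ℝ → ℝ) → (ℝ → ℝ) → Prop)
    (T : (ℝ → ℝ) → (ℝ → ℝ)) : Prop :=
  MapsTo T S S ∧
    ∀ (u : ℕ → ℝ → ℝ) (u₀ : ℝ → ℝ), (∀ k, u k ∈ S) → u₀ ∈ S → conv u u₀ →
      conv (fun k => T (u k)) (T u₀)

/-- The composition operator `T_f u = f(u)`. -/
def compOp (f : ℝ → ℝ) (u : ℝ → ℝ) : ℝ → ℝ := fun x => f (u x)

end OrliczSobolev

namespace OrliczSobolev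

/-! ### Derivatives of a composition with a Lipschitz outer function -/

/-! Two facts reduce the problem to one analytic statement. In each setting of the theorem, a member
of the space is a.e. equal to a bounded primitive of its weak derivative, and modular convergence
forces uniform convergence of these primitives (`IsPrimitiveOn.eventually_abs_le_of_modular` for
`W1`, `exists_enorm_le_lintegral_deriv` for `V10`). Hence only the values of `f` on a compact
interval matter for large `k`, and `f` may be replaced by a globally Lipschitz `F`. The chain rule
then gives `(F ∘ U)' = F'(U) U'` a.e., with `deriv F` a bounded Borel function; its default value at
points of non-differentiability is harmless.

What remains is that `g(U_k) U_k' → g(U) U'` modularly for every bounded Borel `g`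
(`IsPrimitiveOn.tendsto_modular_comp_mul`). Write the difference as `g(U_k)(U_k' - U') + (g(U_k) -
g(U)) U'`. The first term is controlled by the hypothesis. In the second, `g` may be discontinuous,
so `g(U_k) → g(U)` can fail pointwise even though `U_k → U` uniformly.

The remedy is the change of variables `∫_a^b g(U_k) U_k' = ∫_{U_k(a)}^{U_k(b)} g`, whose right side
depends continuously on the endpoints. It yields `∫_a^b (g(U_k) - g(U)) U' → 0` on every compact
subinterval, hence weak convergence of `g(U_k)` to `g(U)` against every integrable density that
vanishes where `U'` does. Applied to both `g` and `g²`, this upgrades to strong convergence: `∫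
(g(U_k) - g(U))² ρ → 0` for such `ρ ≥ 0`. Taking `ρ = A(|U'|/l₀)` and using `A(θt) ≤ θ A(t)` for `θ
≤ 1` bounds the modular of the second term. -/

theorem nhds_le_map_of_hasDerivAt {U : ℝ → ℝ} {v x : ℝ} (hU : HasDerivAt U v x) (hv : v ≠ 0)
    (hc : ∀ᶠ y in 𝓝 x, ContinuousAt U y) : 𝓝 (U x) ≤ map U (𝓝 x) := by
  have hs : ∀ᶠ y in 𝓝[≠] x, 0 < slope U x y * v := by
    have h1 := (hasDerivAt_iff_tendsto_slope.1 hU).mul_const v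
    exact h1.eventually_const_lt (mul_self_pos.2 hv)
  rw [eventually_nhdsWithin_iff] at hs
  intro V hV
  rw [mem_map] at hV
  obtain ⟨δ, hδ, hball⟩ := Metric.eventually_nhds_iff_ball.1 (hs.and (hc.and hV))
  have hsub : uIcc (x - δ / 2) (x + δ / 2) ⊆ Metric.ball x δ := by
    intro y hy
    rw [uIcc_of_le (by linarith), mem_Icc] at hy
    rw [Metric.mem_ball, Real.dist_eq, abs_lt]
    constructor <;> linarith [hy.1, hy.2]
  have hcont : ContinuousOn U (uIcc (x - δ / 2) (x + δ / 2)) := fun y hy =>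
    (hball y (hsub hy)).2.1.continuousWithinAt
  -- The intermediate value theorem makes `U` cover everything between its values at `x ± δ / 2`.
  -- These lie strictly on opposite sides of `U x`, in an order decided by the sign of `v`.
  have hivt := intermediate_value_uIcc hcont
  have hL := (hball (x - δ / 2) (hsub left_mem_uIcc)).1 (by
    simp only [mem_compl_iff, mem_singleton_iff]; linarith)
  have hR := (hball (x + δ / 2) (hsub right_mem_uIcc)).1 (by
    simp only [mem_compl_iff, mem_singleton_iff]; linarith)
  have hsl : ∀ y, slope U x y = (U y - U x) / (y - x) := fun y => slope_def_field U x y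
  rw [hsl] at hL hR
  have e1 : (U (x - δ / 2) - U x) / (x - δ / 2 - x) * v
      = (-(2 / δ)) * ((U (x - δ / 2) - U x) * v) := by
    rw [show x - δ / 2 - x = -(δ / 2) by ring]
    generalize U (x - δ / 2) = p
    field_simp
  have e2 : (U (x + δ / 2) - U x) / (x + δ / 2 - x) * v
      = (2 / δ) * ((U (x + δ / 2) - U x) * v) := by
    rw [show x + δ / 2 - x = δ / 2 by ring]
    generalize U (x + δ / 2) = p
    field_simp
  rw [e1] at hL
  rw [e2] at hR
  have h2δ : 0 < 2 / δ := by positivity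
  have hL' : (U (x - δ / 2) - U x) * v < 0 := by
    by_contra h
    push Not at h
    nlinarith [mul_nonneg h2δ.le h]
  have hR' : 0 < (U (x + δ / 2) - U x) * v := pos_of_mul_pos_right hR h2δ.le
  have hmem : uIcc (U (x - δ / 2)) (U (x + δ / 2)) ∈ 𝓝 (U x) := by
    rcases lt_or_gt_of_ne hv with h | h
    · have a1 : U x < U (x - δ / 2) := by nlinarith
      have a2 : U (x + δ / 2) < U x := by nlinarith
      rw [uIcc_of_ge (by linarith)]
      exact Icc_mem_nhds a2 a1
    · have a1 : U (x - δ / 2) < U x := by nlinarith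
      have a2 : U x < U (x + δ / 2) := by nlinarith
      rw [uIcc_of_le (by linarith)]
      exact Icc_mem_nhds a1 a2
  refine mem_of_superset hmem (hivt.trans ?_)
  rintro _ ⟨y, hy, rfl⟩
  exact (hball y (hsub hy)).2.2

/-- Since `U` covers a neighbourhood of `U x`, a little-o estimate for `F` at `U x` may be tested
along `U`. There `y - x` is bounded by a multiple of `U y - U x`, because `v ≠ 0`. -/
theorem hasDerivAt_of_hasDerivAt_comp {F U : ℝ → ℝ} {v d x : ℝ} (hU : HasDerivAt U v x)
    (hv : v ≠ 0) (hc : ∀ᶠ y in 𝓝 x, ContinuousAt U y)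
    (hFU : HasDerivAt (fun y => F (U y)) d x) : HasDerivAt F (d / v) (U x) := by
  have hle := nhds_le_map_of_hasDerivAt hU hv hc
  rw [hasDerivAt_iff_isLittleO]
  refine Asymptotics.IsLittleO.mono ?_ hle
  rw [Asymptotics.isLittleO_map]
  have h1 := hasDerivAt_iff_isLittleO.1 hFU
  have h2 := hasDerivAt_iff_isLittleO.1 hU
  have h3 := h1.sub (h2.const_mul_left (d / v))
  have h4 : (fun y => y - x) =O[𝓝 x] fun y => (y - x) • v := by
    refine Asymptotics.IsBigO.of_bound (|v|⁻¹) (Eventually.of_forall fun y => ?_)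
    simp only [smul_eq_mul, norm_mul, Real.norm_eq_abs]
    have : 0 < |v| := abs_pos.2 hv
    field_simp
    exact le_rfl
  have h5 : (fun y => (y - x) • v) =O[𝓝 x] fun y => U y - U x :=
    (h2.trans_isBigO h4).right_isBigO_add.congr_right fun y => by ring
  refine (h3.trans_isBigO (h4.trans h5)).congr_left fun y => ?_
  simp only [Function.comp_apply, smul_eq_mul]
  field_simp
  ring

/-- If `F` is Lipschitz and both `U` and `F ∘ U` are differentiable at `x`, the chain rule holds
at `x`, even though `F` need not be differentiable at `U x` when `U` is critical there. -/
theorem eq_deriv_mul_of_hasDerivAt_comp {F U : ℝ → ℝ} {K : ℝ≥0} (hF : LipschitzWith K F)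
    {v d x : ℝ} (hU : HasDerivAt U v x) (hc : ∀ᶠ y in 𝓝 x, ContinuousAt U y)
    (hFU : HasDerivAt (fun y => F (U y)) d x) : d = deriv F (U x) * v := by
  -- At a critical point of `U`, the Lipschitz bound alone makes `F (U y) - F (U x)` of order `o(y -
  -- x)`, so both sides vanish.
  by_cases hv : v = 0
  · subst hv
    have h0 : HasDerivAt (fun y => F (U y)) 0 x := by
      rw [hasDerivAt_iff_isLittleO] at hU ⊢
      simp only [smul_zero, sub_zero] at hU ⊢
      refine Asymptotics.IsBigO.trans_isLittleO ?_ hU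
      refine Asymptotics.IsBigO.of_bound K (Eventually.of_forall fun y => ?_)
      simpa [Real.dist_eq] using hF.dist_le_mul (U y) (U x)
    rw [mul_zero]
    exact hFU.unique h0
  · rw [(hasDerivAt_of_hasDerivAt_comp hU hv hc hFU).deriv]
    field_simp

/-! ### Primitives on an interval -/

/-- `U` is a primitive of the locally integrable function `v` on the interval `I`. -/
structure IsPrimitiveOn (I : Set ℝ) (U v : ℝ → ℝ) : Prop where
  intervalIntegrable : ∀ a ∈ I, ∀ b ∈ I, IntervalIntegrable v volume a b
  sub_eq : ∀ a ∈ I, ∀ b ∈ I, U b - U a = ∫ x in a..b, v x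

/-- Countably many intervals with rational endpoints cover `I`, so the exceptional null sets can be
united. -/
theorem ae_mem_imp_of_forall_Icc {I : Set ℝ} (hI : IsOpen I) {P : ℝ → Prop}
    (h : ∀ a ∈ I, ∀ b ∈ I, a ≤ b → ∀ᵐ x, x ∈ Icc a b → P x) : ∀ᵐ x, x ∈ I → P x := by
  have h1 : ∀ᵐ x : ℝ, ∀ p q : ℚ, (p : ℝ) ∈ I → (q : ℝ) ∈ I → (p : ℝ) ≤ q →
      x ∈ Icc (p : ℝ) q → P x := by
    rw [ae_all_iff]; intro p
    rw [ae_all_iff]; intro q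
    by_cases hp : (p : ℝ) ∈ I
    · by_cases hq : (q : ℝ) ∈ I
      · by_cases hpq : (p : ℝ) ≤ q
        · filter_upwards [h p hp q hq hpq] with x hx _ _ _ using hx
        · exact Eventually.of_forall fun x _ _ h3 => absurd h3 hpq
      · exact Eventually.of_forall fun x _ h3 => absurd h3 hq
    · exact Eventually.of_forall fun x h3 => absurd h3 hp
  filter_upwards [h1] with x hx hxI
  obtain ⟨δ, hδ, hball⟩ := Metric.isOpen_iff.1 hI x hxI
  obtain ⟨p, hp1, hp2⟩ := exists_rat_btwn (show x - δ < x by linarith)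
  obtain ⟨q, hq1, hq2⟩ := exists_rat_btwn (show x < x + δ by linarith)
  refine hx p q (hball ?_) (hball ?_) (by linarith) ⟨hp2.le, hq1.le⟩
  · rw [Metric.mem_ball, Real.dist_eq, abs_lt]; constructor <;> linarith
  · rw [Metric.mem_ball, Real.dist_eq, abs_lt]; constructor <;> linarith

theorem absolutelyContinuousOnInterval_congr {f g : ℝ → ℝ} {a b : ℝ}
    (hf : AbsolutelyContinuousOnInterval f a b) (h : EqOn f g (uIcc a b)) :
    AbsolutelyContinuousOnInterval g a b := by
  rw [absolutelyContinuousOnInterval_iff] at hf ⊢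
  intro ε hε
  obtain ⟨δ, hδ, H⟩ := hf ε hε
  refine ⟨δ, hδ, fun E hE hs => ?_⟩
  convert! H E hE hs using 1
  refine Finset.sum_congr rfl fun i hi => ?_
  rw [h (hE.1 i hi).1, h (hE.1 i hi).2]

theorem absolutelyContinuousOnInterval_lipschitz_comp {F U : ℝ → ℝ} {K : ℝ≥0}
    (hF : LipschitzWith K F) {a b : ℝ} (hU : AbsolutelyContinuousOnInterval U a b) :
    AbsolutelyContinuousOnInterval (fun x => F (U x)) a b := by
  rw [absolutelyContinuousOnInterval_iff] at hU ⊢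
  intro ε hε
  obtain ⟨δ, hδ, H⟩ := hU (ε / (K + 1)) (by positivity)
  refine ⟨δ, hδ, fun E hE hs => ?_⟩
  have h1 := H E hE hs
  rw [lt_div_iff₀ (by positivity)] at h1
  refine lt_of_le_of_lt ?_ h1
  rw [Finset.sum_mul]
  refine Finset.sum_le_sum fun i _ => (hF.dist_le_mul _ _).trans ?_
  nlinarith [dist_nonneg (x := U (E.2 i).1) (y := U (E.2 i).2)]

namespace IsPrimitiveOn

variable {I : Set ℝ} {U v : ℝ → ℝ}

theorem absolutelyContinuousOnInterval (h : IsPrimitiveOn I U v) (hI : I.OrdConnected) {a b : ℝ}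
    (ha : a ∈ I) (hb : b ∈ I) : AbsolutelyContinuousOnInterval U a b := by
  have h1 := (h.intervalIntegrable a ha b hb).absolutelyContinuousOnInterval_intervalIntegral
    (c := a) left_mem_uIcc
  have h2 : AbsolutelyContinuousOnInterval (fun _ : ℝ => U a) a b :=
    (LipschitzWith.const (U a)).lipschitzOnWith.absolutelyContinuousOnInterval
  refine absolutelyContinuousOnInterval_congr (h2.add h1) fun x hx => ?_
  have := h.sub_eq a ha x (hI.uIcc_subset ha hb hx)
  simp only [Pi.add_apply]
  linarith

theorem continuousOn (h : IsPrimitiveOn I U v) (hO : IsOpen I) (hI : I.OrdConnected) :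
    ContinuousOn U I := by
  intro x hx
  obtain ⟨δ, hδ, hball⟩ := Metric.isOpen_iff.1 hO x hx
  have hm : ∀ y, |y - x| < δ → y ∈ I := fun y hy => hball (by
    rwa [Metric.mem_ball, Real.dist_eq])
  have ha : x - δ / 2 ∈ I := hm _ (by rw [abs_lt]; constructor <;> linarith)
  have hb : x + δ / 2 ∈ I := hm _ (by rw [abs_lt]; constructor <;> linarith)
  have hc := (h.absolutelyContinuousOnInterval hI ha hb).continuousOn
  rw [uIcc_of_le (by linarith)] at hc
  exact (hc.continuousAt (Icc_mem_nhds (by linarith) (by linarith))).continuousWithinAt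

theorem ae_hasDerivAt (h : IsPrimitiveOn I U v) (hO : IsOpen I) (hI : I.OrdConnected) :
    ∀ᵐ x, x ∈ I → HasDerivAt U (v x) x := by
  refine ae_mem_imp_of_forall_Icc hO fun a ha b hb hab => ?_
  filter_upwards [(h.intervalIntegrable a ha b hb).ae_hasDerivAt_integral] with x hx hxm
  rw [← uIcc_of_le hab] at hxm
  have hxI := hI.uIcc_subset ha hb hxm
  refine ((hx hxm a left_mem_uIcc).add_const (U a)).congr_of_eventuallyEq ?_
  filter_upwards [hO.mem_nhds hxI] with y hy
  linarith [h.sub_eq a ha y hy]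

theorem ae_congr (h : IsPrimitiveOn I U v) (hI : I.OrdConnected) {w : ℝ → ℝ}
    (hvw : ∀ᵐ x, x ∈ I → v x = w x) : IsPrimitiveOn I U w := by
  have hae : ∀ a ∈ I, ∀ b ∈ I, ∀ᵐ x, x ∈ uIoc a b → v x = w x := fun a ha b hb => by
    filter_upwards [hvw] with x hx hxm
    exact hx (hI.uIcc_subset ha hb (uIoc_subset_uIcc hxm))
  refine ⟨fun a ha b hb => (h.intervalIntegrable a ha b hb).congr_ae ?_, fun a ha b hb => ?_⟩
  · exact (ae_restrict_iff' measurableSet_uIoc).2 (hae a ha b hb)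
  · rw [h.sub_eq a ha b hb]
    exact intervalIntegral.integral_congr_ae (hae a ha b hb)

/-- The chain rule for Lipschitz functions of absolutely continuous functions. -/
theorem lipschitz_comp (h : IsPrimitiveOn I U v) (hO : IsOpen I) (hI : I.OrdConnected)
    {F : ℝ → ℝ} {K : ℝ≥0} (hF : LipschitzWith K F) :
    IsPrimitiveOn I (fun x => F (U x)) (fun x => deriv F (U x) * v x) := by
  have h1 : IsPrimitiveOn I (fun x => F (U x)) (deriv fun x => F (U x)) := by
    refine ⟨fun a ha b hb => ?_, fun a ha b hb => ?_⟩
    · exact (absolutelyContinuousOnInterval_lipschitz_comp hF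
        (h.absolutelyContinuousOnInterval hI ha hb)).intervalIntegrable_deriv
    · exact (absolutelyContinuousOnInterval_lipschitz_comp hF
        (h.absolutelyContinuousOnInterval hI ha hb)).integral_deriv_eq_sub.symm
  refine h1.ae_congr hI ?_
  filter_upwards [h.ae_hasDerivAt hO hI, h1.ae_hasDerivAt hO hI] with x hx1 hx2 hxI
  refine eq_deriv_mul_of_hasDerivAt_comp hF (hx1 hxI) ?_ (hx2 hxI)
  filter_upwards [hO.mem_nhds hxI] with y hy
  exact (h.continuousOn hO hI).continuousAt (hO.mem_nhds hy)

theorem sub (h : IsPrimitiveOn I U v) {W w : ℝ → ℝ} (h' : IsPrimitiveOn I W w) :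
    IsPrimitiveOn I (fun x => U x - W x) (fun x => v x - w x) := by
  refine ⟨fun a ha b hb => (h.intervalIntegrable a ha b hb).sub (h'.intervalIntegrable a ha b hb),
    fun a ha b hb => ?_⟩
  rw [intervalIntegral.integral_sub (h.intervalIntegrable a ha b hb)
    (h'.intervalIntegrable a ha b hb), ← h.sub_eq a ha b hb, ← h'.sub_eq a ha b hb]
  ring

end IsPrimitiveOn

/-! ### Change of variables for bounded measurable functions -/

theorem ae_eq_zero_of_forall_intervalIntegral_eq_zero {I : Set ℝ} (hO : IsOpen I) {w : ℝ → ℝ}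
    (hw : ∀ a ∈ I, ∀ b ∈ I, IntervalIntegrable w volume a b) (hI : I.OrdConnected)
    (h0 : ∀ a ∈ I, ∀ b ∈ I, ∫ x in a..b, w x = 0) : ∀ᵐ x, x ∈ I → w x = 0 := by
  have h : IsPrimitiveOn I (fun _ => 0) w := ⟨hw, fun a ha b hb => by rw [h0 a ha b hb]; simp⟩
  filter_upwards [h.ae_hasDerivAt hO hI] with x hx hxI
  exact (hx hxI).unique (hasDerivAt_const x (0 : ℝ))

theorem intervalIntegrable_mul_of_bounded {w v : ℝ → ℝ} {a b C : ℝ}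
    (hw : AEStronglyMeasurable w (volume.restrict (uIoc a b))) (hC : ∀ x, |w x| ≤ C)
    (hv : IntervalIntegrable v volume a b) :
    IntervalIntegrable (fun x => w x * v x) volume a b := by
  rw [intervalIntegrable_iff] at hv ⊢
  exact Integrable.bdd_mul hv hw (Eventually.of_forall hC)

theorem lipschitzWith_integral {g : ℝ → ℝ} {K : ℝ≥0} (hg : Measurable g) (hK : ∀ x, |g x| ≤ K) :
    LipschitzWith K (fun t => ∫ s in (0 : ℝ)..t, g s) := by
  have hint : ∀ a b, IntervalIntegrable g volume a b := fun a b => by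
    simpa using intervalIntegrable_mul_of_bounded (v := fun _ => (1 : ℝ)) (a := a) (b := b)
      hg.aestronglyMeasurable hK intervalIntegrable_const
  refine LipschitzWith.of_dist_le_mul fun x y => ?_
  rw [Real.dist_eq, intervalIntegral.integral_interval_sub_left (hint _ _) (hint _ _)]
  have := intervalIntegral.norm_integral_le_of_norm_le_const (a := y) (b := x) (f := g)
    (C := K) (fun s _ => hK s)
  rwa [Real.norm_eq_abs] at this

theorem intervalIntegrable_of_bounded {g : ℝ → ℝ} {C : ℝ} (hg : Measurable g)
    (hK : ∀ x, |g x| ≤ C) (a b : ℝ) : IntervalIntegrable g volume a b := by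
  simpa using intervalIntegrable_mul_of_bounded (v := fun _ => (1 : ℝ)) (a := a) (b := b)
    hg.aestronglyMeasurable hK intervalIntegrable_const

namespace IsPrimitiveOn

variable {I : Set ℝ} {U v : ℝ → ℝ}

theorem aestronglyMeasurable_comp (h : IsPrimitiveOn I U v) (hO : IsOpen I) (hI : I.OrdConnected)
    {g : ℝ → ℝ} (hg : Measurable g) :
    AEStronglyMeasurable (fun x => g (U x)) (volume.restrict I) :=
  (hg.comp_aemeasurable
    ((h.continuousOn hO hI).aemeasurable hO.measurableSet)).aestronglyMeasurable

theorem intervalIntegrable_comp_mul (h : IsPrimitiveOn I U v) (hO : IsOpen I)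
    (hI : I.OrdConnected) {g : ℝ → ℝ} (hg : Measurable g) {C : ℝ} (hC : ∀ x, |g x| ≤ C)
    {a b : ℝ} (ha : a ∈ I) (hb : b ∈ I) :
    IntervalIntegrable (fun x => g (U x) * v x) volume a b :=
  intervalIntegrable_mul_of_bounded ((h.aestronglyMeasurable_comp hO hI hg).mono_measure
    (Measure.restrict_mono (uIoc_subset_uIcc.trans (hI.uIcc_subset ha hb)) le_rfl))
    (fun x => hC (U x)) (h.intervalIntegrable a ha b hb)

/-- A π-λ induction starting from the half-lines `Iic c`, for which the identity is the chain rule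
for `min t c`. -/
theorem integral_indicator_comp_mul (h : IsPrimitiveOn I U v) (hO : IsOpen I)
    (hI : I.OrdConnected) {a b : ℝ} (ha : a ∈ I) (hb : b ∈ I) {E : Set ℝ} (hE : MeasurableSet E) :
    ∫ x in a..b, E.indicator 1 (U x) * v x = ∫ t in U a..U b, E.indicator 1 t := by
  have hbd : ∀ (E : Set ℝ) (x : ℝ), |E.indicator (1 : ℝ → ℝ) x| ≤ 1 := fun E x => by
    by_cases hx : x ∈ E <;> simp [hx]
  have hmeas : ∀ {E : Set ℝ}, MeasurableSet E → Measurable (E.indicator (1 : ℝ → ℝ)) :=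
    fun hE => measurable_one.indicator hE
  induction E, hE using MeasurableSpace.induction_on_inter (borel_eq_generateFrom_Iic ℝ)
    isPiSystem_Iic with
  | empty => simp
  | basic E hE =>
    obtain ⟨c, rfl⟩ := hE
    have hL : LipschitzWith 1 (fun t : ℝ => min t c) := by
      simpa using (LipschitzWith.id (α := ℝ)).min_const c
    have hd : ∀ t, t ≠ c → deriv (fun t : ℝ => min t c) t = (Iic c).indicator 1 t := by
      intro t ht
      rcases lt_or_gt_of_ne ht with h1 | h1
      · rw [indicator_of_mem (mem_Iic.2 h1.le)]
        have : (fun t : ℝ => min t c) =ᶠ[𝓝 t] id := by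
          filter_upwards [Iio_mem_nhds h1] with s hs using min_eq_left (le_of_lt hs)
        rw [this.deriv_eq]; simp
      · rw [indicator_of_notMem (by simpa using h1)]
        have : (fun t : ℝ => min t c) =ᶠ[𝓝 t] fun _ => c := by
          filter_upwards [Ioi_mem_nhds h1] with s hs using min_eq_right (le_of_lt hs)
        rw [this.deriv_eq]; simp
    have hcomp := h.lipschitz_comp hO hI hL
    have hRHS : ∫ t in U a..U b, (Iic c).indicator (1 : ℝ → ℝ) t
        = ∫ t in U a..U b, deriv (fun t : ℝ => min t c) t := by
      refine intervalIntegral.integral_congr_ae ?_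
      filter_upwards [Measure.ae_ne volume c] with t ht _ using (hd t ht).symm
    rw [hRHS, (hL.lipschitzOnWith.absolutelyContinuousOnInterval).integral_deriv_eq_sub,
      hcomp.sub_eq a ha b hb]
    refine intervalIntegral.integral_congr_ae ?_
    filter_upwards [h.ae_hasDerivAt hO hI, hcomp.ae_hasDerivAt hO hI] with x hx1 hx2 hxm
    have hxI := hI.uIcc_subset ha hb (uIoc_subset_uIcc hxm)
    by_cases hUx : U x = c
    · by_cases hv : v x = 0
      · simp [hv]
      -- If `U x = c` and `v x ≠ 0`, then `min t c` would be differentiable at its corner `c`,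
      -- although its one-sided derivatives there are 1 and 0.
      · exfalso
        have hc : ∀ᶠ y in 𝓝 x, ContinuousAt U y := by
          filter_upwards [hO.mem_nhds hxI] with y hy
          exact (h.continuousOn hO hI).continuousAt (hO.mem_nhds hy)
        have hd := (hasDerivAt_of_hasDerivAt_comp (F := fun t => min t c) (hx1 hxI)
          hv hc (hx2 hxI)).differentiableAt
        rw [hUx] at hd
        have h1 : deriv (fun t : ℝ => min t c) c = 1 := by
          have := hd.hasDerivAt.hasDerivWithinAt (s := Iic c)
          have h2 : HasDerivWithinAt (fun t : ℝ => min t c) 1 (Iic c) c :=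
            (hasDerivWithinAt_id c _).congr (fun y hy => min_eq_left hy) (by simp)
          exact (uniqueDiffWithinAt_Iic c).eq_deriv _ this h2
        have h1' : deriv (fun t : ℝ => min t c) c = 0 := by
          have := hd.hasDerivAt.hasDerivWithinAt (s := Ici c)
          have h2 : HasDerivWithinAt (fun t : ℝ => min t c) 0 (Ici c) c :=
            (hasDerivWithinAt_const c _ c).congr (fun y hy => min_eq_right hy) (by simp)
          exact (uniqueDiffWithinAt_Ici c).eq_deriv _ this h2
        linarith
    · rw [hd _ hUx]
  | compl E hE ih =>
    have hc : ∀ t, Eᶜ.indicator (1 : ℝ → ℝ) t = 1 - E.indicator 1 t := fun t => by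
      by_cases ht : t ∈ E <;> simp [ht]
    simp only [hc, sub_mul, one_mul]
    rw [intervalIntegral.integral_sub (h.intervalIntegrable a ha b hb)
      (h.intervalIntegrable_comp_mul hO hI (hmeas hE) (hbd E) ha hb), ih,
      intervalIntegral.integral_sub intervalIntegrable_const
      (intervalIntegrable_of_bounded (hmeas hE) (hbd E) _ _), ← h.sub_eq a ha b hb]
    simp
  | iUnion f hd hf ih =>
    have hs : ∀ t, HasSum (fun i => (f i).indicator (1 : ℝ → ℝ) t)
        ((⋃ i, f i).indicator 1 t) := fun t => by
      by_cases ht : t ∈ ⋃ i, f i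
      · obtain ⟨i, hi⟩ := mem_iUnion.1 ht
        have hj : ∀ j, j ≠ i → (f j).indicator (1 : ℝ → ℝ) t = 0 := fun j hj =>
          indicator_of_notMem (fun h => (hd hj).notMem_of_mem_left h hi) _
        rw [indicator_of_mem ht, ← indicator_of_mem hi (1 : ℝ → ℝ)]
        exact hasSum_single i hj
      · rw [indicator_of_notMem ht]
        have : ∀ i, (f i).indicator (1 : ℝ → ℝ) t = 0 := fun i =>
          indicator_of_notMem (fun h => ht (mem_iUnion.2 ⟨i, h⟩)) _
        simp only [this]
        exact hasSum_zero
    have hps : ∀ n t, |∑ i ∈ Finset.range n, (f i).indicator (1 : ℝ → ℝ) t| ≤ 1 := by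
      intro n t
      have h0 : ∀ i, 0 ≤ (f i).indicator (1 : ℝ → ℝ) t := fun i =>
        indicator_nonneg (fun _ _ => zero_le_one) _
      rw [abs_of_nonneg (Finset.sum_nonneg fun i _ => h0 i)]
      exact (sum_le_hasSum _ (fun i _ => h0 i) (hs t)).trans ((le_abs_self _).trans (hbd _ t))
    have e1 : Tendsto (fun n => ∫ x in a..b,
        (∑ i ∈ Finset.range n, (f i).indicator (1 : ℝ → ℝ) (U x)) * v x) atTop
        (𝓝 (∫ x in a..b, (⋃ i, f i).indicator 1 (U x) * v x)) := by
      refine intervalIntegral.tendsto_integral_filter_of_dominated_convergence (fun x => |v x|)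
        (Eventually.of_forall fun n => ?_) (Eventually.of_forall fun n => ?_)
        (h.intervalIntegrable a ha b hb).abs (Eventually.of_forall fun x _ => ?_)
      · exact (h.intervalIntegrable_comp_mul hO hI
          (g := fun t => ∑ i ∈ Finset.range n, (f i).indicator (1 : ℝ → ℝ) t)
          (Finset.measurable_fun_sum _ fun i _ => hmeas (hf i)) (hps n)
          ha hb).def'.aestronglyMeasurable
      · refine Eventually.of_forall fun x _ => ?_
        rw [Real.norm_eq_abs, abs_mul]
        exact mul_le_of_le_one_left (abs_nonneg _) (hps n _)
      · exact (hs (U x)).tendsto_sum_nat.mul_const _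
    have e2 : Tendsto (fun n => ∫ t in U a..U b,
        (∑ i ∈ Finset.range n, (f i).indicator (1 : ℝ → ℝ) t)) atTop
        (𝓝 (∫ t in U a..U b, (⋃ i, f i).indicator 1 t)) := by
      refine intervalIntegral.tendsto_integral_filter_of_dominated_convergence (fun x => 1)
        (Eventually.of_forall fun n => ?_) (Eventually.of_forall fun n => ?_)
        intervalIntegrable_const (Eventually.of_forall fun x _ => (hs x).tendsto_sum_nat)
      · exact (Finset.measurable_fun_sum _ fun i _ => hmeas (hf i)).aestronglyMeasurable
      · exact Eventually.of_forall fun x _ => hps n x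
    refine tendsto_nhds_unique e1 (e2.congr fun n => ?_)
    simp only [Finset.sum_mul]
    rw [intervalIntegral.integral_finsetSum, intervalIntegral.integral_finsetSum]
    · exact Finset.sum_congr rfl fun i _ => (ih i).symm
    · exact fun i _ => h.intervalIntegrable_comp_mul hO hI (hmeas (hf i)) (hbd _) ha hb
    · exact fun i _ => intervalIntegrable_of_bounded (hmeas (hf i)) (hbd _) _ _

/-- The derivative vanishes a.e. on the preimage of a null set. -/
theorem ae_eq_zero_of_comp_mem_null (h : IsPrimitiveOn I U v) (hO : IsOpen I)
    (hI : I.OrdConnected) {N : Set ℝ} (hN : volume N = 0) :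
    ∀ᵐ x, x ∈ I → U x ∈ N → v x = 0 := by
  set E := toMeasurable volume N
  have hE : MeasurableSet E := measurableSet_toMeasurable _ _
  have hE0 : volume E = 0 := by rw [measure_toMeasurable, hN]
  have hbd : ∀ (x : ℝ), |E.indicator (1 : ℝ → ℝ) x| ≤ 1 := fun x => by
    by_cases hx : x ∈ E <;> simp [hx]
  have key := ae_eq_zero_of_forall_intervalIntegral_eq_zero hO
    (w := fun x => E.indicator 1 (U x) * v x)
    (fun a ha b hb => h.intervalIntegrable_comp_mul hO hI (measurable_one.indicator hE) hbd ha hb)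
    hI (fun a ha b hb => by
      rw [h.integral_indicator_comp_mul hO hI ha hb hE]
      refine (intervalIntegral.integral_congr_ae (g := fun _ => 0) ?_).trans (by simp)
      filter_upwards [measure_eq_zero_iff_ae_notMem.1 hE0] with x hx _
      rw [indicator_of_notMem hx])
  filter_upwards [key] with x hx hxI hxN
  have := hx hxI
  rw [indicator_of_mem (subset_toMeasurable _ _ hxN)] at this
  simpa using this

/-- This is the chain rule for the Lipschitz primitive of `g`. By Lebesgue differentiation its
derivative is `g` off a null set, and `v` vanishes a.e. on the preimage under `U` of that set. -/
theorem integral_comp_mul (h : IsPrimitiveOn I U v) (hO : IsOpen I) (hI : I.OrdConnected)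
    {g : ℝ → ℝ} (hg : Measurable g) {K : ℝ≥0} (hK : ∀ x, |g x| ≤ K) {a b : ℝ} (ha : a ∈ I)
    (hb : b ∈ I) : ∫ x in a..b, g (U x) * v x = ∫ t in U a..U b, g t := by
  have hint := intervalIntegrable_of_bounded hg hK
  have hloc : LocallyIntegrable g volume := by
    refine (locallyIntegrable_const (K : ℝ)).mono hg.aestronglyMeasurable
      (Eventually.of_forall fun x => ?_)
    simpa using hK x
  have hnull : volume {t | deriv (fun t => ∫ s in (0 : ℝ)..t, g s) t ≠ g t} = 0 := by
    have : ∀ᵐ t, deriv (fun t => ∫ s in (0 : ℝ)..t, g s) t = g t := by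
      filter_upwards [LocallyIntegrable.ae_hasDerivAt_integral hloc] with t ht using (ht 0).deriv
    exact ae_iff.1 this
  have hcomp := h.lipschitz_comp hO hI (lipschitzWith_integral hg hK)
  have h1 := hcomp.sub_eq a ha b hb
  rw [intervalIntegral.integral_interval_sub_left (hint _ _) (hint _ _)] at h1
  rw [h1]
  refine intervalIntegral.integral_congr_ae ?_
  filter_upwards [h.ae_eq_zero_of_comp_mem_null hO hI hnull] with x hx hxm
  have hxI := hI.uIcc_subset ha hb (uIoc_subset_uIcc hxm)
  by_cases hc : deriv (fun t => ∫ s in (0 : ℝ)..t, g s) (U x) = g (U x)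
  · rw [hc]
  · rw [hx hxI hc]; simp

end IsPrimitiveOn

/-! ### Weak derivatives and primitives -/

theorem exists_Icc_nhds_subset {I : Set ℝ} (hO : IsOpen I) {x : ℝ} (hx : x ∈ I) :
    ∃ δ > 0, Icc (x - δ) (x + δ) ⊆ I := by
  obtain ⟨δ, hδ, hball⟩ := Metric.isOpen_iff.1 hO x hx
  refine ⟨δ / 2, by positivity, fun y hy => hball ?_⟩
  rw [Metric.mem_ball, Real.dist_eq, abs_lt]
  constructor <;> linarith [hy.1, hy.2]

theorem exists_Ioo_of_isCompact {I : Set ℝ} (hO : IsOpen I) (hne : I.Nonempty) {S : Set ℝ}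
    (hS : IsCompact S) (hSI : S ⊆ I) : ∃ a ∈ I, ∃ b ∈ I, a < b ∧ S ⊆ Ioo a b := by
  obtain ⟨x, hx⟩ := hne
  -- Adjoining a point of `I` covers the case of empty `S`, in which `sInf` and `sSup` would carry
  -- no information.
  have hT : IsCompact (insert x S) := hS.insert x
  have hTI : insert x S ⊆ I := insert_subset hx hSI
  have hTn : (insert x S).Nonempty := insert_nonempty _ _
  obtain ⟨δ, hδ, h1⟩ := exists_Icc_nhds_subset hO (hTI (hT.sInf_mem hTn))
  obtain ⟨η, hη, h2⟩ := exists_Icc_nhds_subset hO (hTI (hT.sSup_mem hTn))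
  have hlo : ∀ y ∈ insert x S, sInf (insert x S) ≤ y := fun y hy => csInf_le hT.bddBelow hy
  have hhi : ∀ y ∈ insert x S, y ≤ sSup (insert x S) := fun y hy => le_csSup hT.bddAbove hy
  refine ⟨_, h1 ⟨le_rfl, by linarith⟩, _, h2 ⟨by linarith, le_rfl⟩, ?_, fun y hy => ?_⟩
  · linarith [hlo x (mem_insert _ _), hhi x (mem_insert _ _)]
  · have hy' := mem_insert_of_mem x hy
    exact ⟨by linarith [hlo y hy'], by linarith [hhi y hy']⟩

theorem setIntegral_eq_intervalIntegral {I : Set ℝ} (hI : I.OrdConnected) (hO : IsOpen I)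
    {a b : ℝ} (ha : a ∈ I) (hb : b ∈ I) (hab : a < b) {f : ℝ → ℝ}
    (hf : ∀ x, x ∉ Ioo a b → f x = 0) : ∫ x in I, f x = ∫ x in a..b, f x := by
  rw [intervalIntegral.integral_of_le hab.le]
  refine setIntegral_eq_of_subset_of_forall_sdiff_eq_zero hO.measurableSet
    (Ioc_subset_Icc_self.trans (hI.out ha hb)) fun x hx => hf x fun h => hx.2 ?_
  exact Ioo_subset_Ioc_self h

theorem locallyIntegrableOn_congr_ae {I : Set ℝ} (hO : IsOpen I) {u w : ℝ → ℝ}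
    (hu : LocallyIntegrableOn u I volume) (h : ∀ᵐ x, x ∈ I → u x = w x) :
    LocallyIntegrableOn w I volume := by
  intro x hx
  obtain ⟨s, hs, hsi⟩ := hu x hx
  refine ⟨s ∩ I, inter_mem hs self_mem_nhdsWithin, ?_⟩
  refine (hsi.mono_set inter_subset_left).congr ?_
  refine ae_restrict_of_ae_restrict_of_subset (inter_subset_right) ?_
  exact (ae_restrict_iff' hO.measurableSet).2 h

theorem IsPrimitiveOn.locallyIntegrableOn {I : Set ℝ} {U v : ℝ → ℝ} (h : IsPrimitiveOn I U v)
    (hO : IsOpen I) : LocallyIntegrableOn v I volume := by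
  intro x hx
  obtain ⟨δ, hδ, hs⟩ := exists_Icc_nhds_subset hO hx
  refine ⟨Icc (x - δ) (x + δ), mem_nhdsWithin_of_mem_nhds
    (Icc_mem_nhds (by linarith) (by linarith)), ?_⟩
  have := h.intervalIntegrable _ (hs ⟨le_rfl, by linarith⟩) _ (hs ⟨by linarith, le_rfl⟩)
  rwa [intervalIntegrable_iff_integrableOn_Icc_of_le (by linarith)] at this

/-- Integration by parts for absolutely continuous functions on a compact interval that contains the
support of the test function in its interior. -/
theorem IsPrimitiveOn.isWeakDeriv {I : Set ℝ} {u U v : ℝ → ℝ} (h : IsPrimitiveOn I U v)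
    (hO : IsOpen I) (hI : I.OrdConnected) (hu : ∀ᵐ x, x ∈ I → u x = U x) :
    IsWeakDeriv I u v := by
  have hUl : LocallyIntegrableOn U I volume :=
    (h.continuousOn hO hI).locallyIntegrableOn hO.measurableSet
  refine ⟨locallyIntegrableOn_congr_ae hO hUl (hu.mono fun x hx hxI => (hx hxI).symm),
    h.locallyIntegrableOn hO, fun φ hφ hc hs => ?_⟩
  rcases I.eq_empty_or_nonempty with rfl | hne
  · simp
  obtain ⟨a, ha, b, hb, hab, hsub⟩ := exists_Ioo_of_isCompact hO hne hc hs
  have hφ0 : ∀ x, x ∉ Ioo a b → φ x = 0 := fun x hx =>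
    image_eq_zero_of_notMem_tsupport fun h => hx (hsub h)
  have hφd : ∀ x, x ∉ Ioo a b → deriv φ x = 0 := fun x hx =>
    image_eq_zero_of_notMem_tsupport fun h => hx (hsub (tsupport_deriv_subset h))
  have e0 : ∫ x in I, u x * deriv φ x = ∫ x in I, U x * deriv φ x := by
    refine setIntegral_congr_ae hO.measurableSet ?_
    filter_upwards [hu] with x hx hxI
    rw [hx hxI]
  have hUac := h.absolutelyContinuousOnInterval hI ha hb
  have hφac : AbsolutelyContinuousOnInterval φ a b :=
    ContDiffOn.absolutelyContinuousOnInterval (hφ.of_le (by simp)).contDiffOn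
  rw [e0, setIntegral_eq_intervalIntegral hI hO ha hb hab fun x hx => by rw [hφd x hx, mul_zero],
    setIntegral_eq_intervalIntegral hI hO ha hb hab fun x hx => by rw [hφ0 x hx, mul_zero],
    hUac.integral_mul_deriv_eq_deriv_mul hφac, hφ0 a (by simp), hφ0 b (by simp)]
  simp only [mul_zero, sub_zero, zero_sub, neg_inj]
  refine intervalIntegral.integral_congr_ae ?_
  filter_upwards [h.ae_hasDerivAt hO hI] with x hx hxm
  rw [(hx (hI.uIcc_subset ha hb (uIoc_subset_uIcc hxm))).deriv]

/-- Du Bois-Reymond's lemma on an open interval. -/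
theorem ae_eq_const_of_integral_mul_deriv_eq_zero {I : Set ℝ} (hO : IsOpen I)
    (hI : I.OrdConnected) {w : ℝ → ℝ} (hw : LocallyIntegrableOn w I volume)
    (h : ∀ φ : ℝ → ℝ, ContDiff ℝ ∞ φ → HasCompactSupport φ → tsupport φ ⊆ I →
      ∫ x in I, w x * deriv φ x = 0) : ∃ c, ∀ᵐ x, x ∈ I → w x = c := by
  rcases I.eq_empty_or_nonempty with rfl | hne
  · exact ⟨0, by simp⟩
  have hint : ∀ φ : ℝ → ℝ, Continuous φ → HasCompactSupport φ → tsupport φ ⊆ I →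
      IntegrableOn (fun x => w x * φ x) I := by
    intro φ hφ hc hs
    have h3 : IntegrableOn (fun x => w x * φ x) (tsupport φ) volume :=
      (hw.integrableOn_compact_subset hs hc).mul_continuousOn hφ.continuousOn hc
    refine ((integrableOn_iff_integrable_of_support_subset ?_).1 h3).integrableOn
    intro x hx
    apply subset_tsupport φ
    intro h0
    exact hx (by simp [h0])
  obtain ⟨x₀, hx₀⟩ := hne
  obtain ⟨δ, hδ, hball⟩ := exists_Icc_nhds_subset hO hx₀
  let B : ContDiffBump x₀ := ⟨δ / 2, δ, by positivity, by linarith⟩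
  set η : ℝ → ℝ := B.normed volume with hη
  have hηs : ContDiff ℝ ∞ η := B.contDiff_normed
  have hηc : HasCompactSupport η := B.hasCompactSupport_normed
  have hηI : tsupport η ⊆ I := by
    rw [hη, B.tsupport_normed_eq]
    refine subset_trans ?_ hball
    rw [Real.closedBall_eq_Icc]
  have hη1 : ∫ x, η x = 1 := B.integral_normed
  refine ⟨∫ x in I, w x * η x, ?_⟩
  set c := ∫ x in I, w x * η x with hcdef
  have key := hO.ae_eq_zero_of_integral_contDiff_smul_eq_zero (μ := volume)
    (f := fun x => w x - c) (hw.sub ((locallyIntegrable_const c).locallyIntegrableOn I)) (by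
    intro φ hφ hφc hφI
    set m := ∫ x, φ x with hm
    -- Subtracting the multiple `m` of the unit-mass bump `η` gives mean zero, so the antiderivative
    -- of `ψ` is again compactly supported in `I` and is an admissible test function.
    set ψ : ℝ → ℝ := fun x => φ x - m * η x with hψ
    have hψs : ContDiff ℝ ∞ ψ := hφ.sub (contDiff_const.mul hηs)
    obtain ⟨a, ha, b, hb, hab, hsub⟩ := exists_Ioo_of_isCompact hO ⟨x₀, hx₀⟩
      (hφc.isCompact.union hηc.isCompact) (union_subset hφI hηI)
    have hφ0 : ∀ x, x ∉ Ioo a b → φ x = 0 := fun x hx =>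
      image_eq_zero_of_notMem_tsupport fun h => hx (hsub (Or.inl h))
    have hη0 : ∀ x, x ∉ Ioo a b → η x = 0 := fun x hx =>
      image_eq_zero_of_notMem_tsupport fun h => hx (hsub (Or.inr h))
    have hψ0 : ∀ x, x ∉ Ioo a b → ψ x = 0 := fun x hx => by
      simp only [hψ, hφ0 x hx, hη0 x hx, mul_zero, sub_zero]
    set Ψ : ℝ → ℝ := fun x => ∫ t in a..x, ψ t with hΨ
    have hd : ∀ x, HasDerivAt Ψ (ψ x) x := fun x =>
      intervalIntegral.integral_hasDerivAt_right (hψs.continuous.intervalIntegrable _ _)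
        hψs.continuous.stronglyMeasurable.stronglyMeasurableAtFilter hψs.continuous.continuousAt
    have hderiv : deriv Ψ = ψ := funext fun x => (hd x).deriv
    have hΨs : ContDiff ℝ ∞ Ψ := by
      rw [contDiff_infty_iff_deriv, hderiv]
      exact ⟨fun x => (hd x).differentiableAt, hψs⟩
    have htot : ∀ f : ℝ → ℝ, (∀ x, x ∉ Ioo a b → f x = 0) → ∫ x in a..b, f x = ∫ x, f x := by
      intro f hf
      rw [← setIntegral_eq_intervalIntegral ordConnected_univ isOpen_univ (mem_univ a)
        (mem_univ b) hab hf, setIntegral_univ]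
    have hψb : ∫ t in a..b, ψ t = 0 := by
      rw [htot ψ hψ0, hψ, integral_sub (hφ.continuous.integrable_of_hasCompactSupport hφc)
        ((hηs.continuous.integrable_of_hasCompactSupport hηc).const_mul m),
        integral_const_mul, hη1, ← hm]
      ring
    have hΨ0 : ∀ x, x ∉ Icc a b → Ψ x = 0 := by
      intro x hx
      rcases lt_or_ge x a with h1 | h1
      · refine (intervalIntegral.integral_congr (g := fun _ => 0) fun t ht => ?_).trans (by simp)
        rw [uIcc_of_ge h1.le] at ht
        exact hψ0 t fun h => absurd h.1 (not_lt.2 ht.2)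
      · have h2 : b < x := by
          by_contra h2
          exact hx ⟨h1, not_lt.1 h2⟩
        have hadd := intervalIntegral.integral_add_adjacent_intervals
          (hψs.continuous.intervalIntegrable (μ := volume) a b)
          (hψs.continuous.intervalIntegrable b x)
        have hz : ∫ t in b..x, ψ t = 0 := by
          refine (intervalIntegral.integral_congr (g := fun _ => 0) fun t ht => ?_).trans (by simp)
          rw [uIcc_of_le h2.le] at ht
          exact hψ0 t fun h => absurd h.2 (not_lt.2 ht.1)
        change ∫ t in a..x, ψ t = 0
        rw [← hadd, hψb, hz, add_zero]
    have hΨsupp : tsupport Ψ ⊆ Icc a b :=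
      closure_minimal (fun x hx => by_contra fun h => hx (hΨ0 x h)) isClosed_Icc
    have hΨc : HasCompactSupport Ψ := HasCompactSupport.of_support_subset_isCompact
      isCompact_Icc ((subset_tsupport _).trans hΨsupp)
    have h0 := h Ψ hΨs hΨc (hΨsupp.trans (hI.out ha hb))
    rw [hderiv] at h0
    have i1 := hint φ hφ.continuous hφc hφI
    have i2 := hint η hηs.continuous hηc hηI
    have e1 : ∫ x in I, w x * ψ x = (∫ x in I, w x * φ x) - m * c := by
      rw [hcdef, ← integral_const_mul, ← integral_sub i1 (i2.const_mul m)]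
      refine integral_congr_ae (Eventually.of_forall fun x => ?_)
      simp only [hψ]; ring
    have hφI0 : ∀ x, x ∉ I → φ x = 0 := fun x hx =>
      image_eq_zero_of_notMem_tsupport fun h => hx (hφI h)
    have e2 : ∫ x, φ x • (w x - c) = ∫ x in I, (w x * φ x - c * φ x) := by
      rw [setIntegral_eq_integral_of_forall_compl_eq_zero fun x hx => by rw [hφI0 x hx]; ring]
      refine integral_congr_ae (Eventually.of_forall fun x => ?_)
      simp only [smul_eq_mul]; ring
    rw [e2, integral_sub i1
      ((hφ.continuous.integrable_of_hasCompactSupport hφc).const_mul c).integrableOn,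
      integral_const_mul, setIntegral_eq_integral_of_forall_compl_eq_zero hφI0, ← hm]
    linarith)
  filter_upwards [key] with x hx hxI
  linarith [hx hxI]

/-- The difference between `u` and an indefinite integral of `v` has zero weak derivative, hence is
a.e. constant on the interval. -/
theorem IsWeakDeriv.exists_primitive {I : Set ℝ} (hO : IsOpen I) (hI : I.OrdConnected)
    {u v : ℝ → ℝ} (h : IsWeakDeriv I u v) :
    ∃ U, IsPrimitiveOn I U v ∧ ∀ᵐ x, x ∈ I → u x = U x := by
  rcases I.eq_empty_or_nonempty with rfl | ⟨a, ha⟩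
  · exact ⟨u, ⟨by simp, by simp⟩, by simp⟩
  have hvi : ∀ p ∈ I, ∀ q ∈ I, IntervalIntegrable v volume p q := fun p hp q hq =>
    (h.locInt_deriv.integrableOn_compact_subset (hI.uIcc_subset hp hq)
      isCompact_uIcc).intervalIntegrable
  have hP : ∀ c : ℝ, IsPrimitiveOn I (fun x => c + ∫ t in a..x, v t) v := fun c =>
    ⟨hvi, fun p hp q hq => by
      rw [add_sub_add_left_eq_sub,
        intervalIntegral.integral_interval_sub_left (hvi a ha q hq) (hvi a ha p hp)]⟩
  have hW := (hP 0).isWeakDeriv hO hI (Eventually.of_forall fun x _ => rfl)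
  obtain ⟨c, hc⟩ := ae_eq_const_of_integral_mul_deriv_eq_zero hO hI
    (h.locInt.sub hW.locInt) (by
      intro φ hφ hφc hs
      have hint : ∀ g : ℝ → ℝ, LocallyIntegrableOn g I volume →
          IntegrableOn (fun x => g x * deriv φ x) I volume := by
        intro g hg
        have hs' : tsupport (deriv φ) ⊆ I := tsupport_deriv_subset.trans hs
        have h3 : IntegrableOn (fun x => g x * deriv φ x) (tsupport (deriv φ)) volume :=
          (hg.integrableOn_compact_subset hs' hφc.deriv).mul_continuousOn
            (hφ.continuous_deriv (by simp)).continuousOn hφc.deriv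
        refine ((integrableOn_iff_integrable_of_support_subset ?_).1 h3).integrableOn
        intro x hx
        apply subset_tsupport (deriv φ)
        intro h0
        exact hx (by simp [h0])
      simp only [Pi.sub_apply, sub_mul]
      rw [integral_sub (hint u h.locInt) (hint _ hW.locInt), h.integral_eq φ hφ hφc hs,
        hW.integral_eq φ hφ hφc hs, sub_self])
  refine ⟨_, hP c, ?_⟩
  filter_upwards [hc] with x hx hxI
  have := hx hxI
  simp only [Pi.sub_apply] at this
  linarith

/-! ### Weak-star convergence of bounded sequences -/

section WeakStar

variable {α : Type*} [MeasurableSpace α] {μ : Measure α} {h : ℕ → α → ℝ} {C : ℝ}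

/-- The uniform bound on `h k` makes the error of replacing `ρ` by `σ` at most `(|C| + 1) ‖ρ - σ‖₁`,
uniformly in `k`. -/
theorem tendsto_integral_mul_zero_of_approx (hm : ∀ k, AEStronglyMeasurable (h k) μ)
    (hC : ∀ k x, |h k x| ≤ C) {ρ : α → ℝ} (hρ : Integrable ρ μ)
    (H : ∀ ε > 0, ∃ σ, Integrable σ μ ∧ ∫ x, |ρ x - σ x| ∂μ ≤ ε ∧
      Tendsto (fun k => ∫ x, h k x * σ x ∂μ) atTop (𝓝 0)) :
    Tendsto (fun k => ∫ x, h k x * ρ x ∂μ) atTop (𝓝 0) := by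
  rw [Metric.tendsto_atTop]
  intro ε hε
  obtain ⟨σ, hσ, hσε, hσt⟩ := H (ε / (2 * (|C| + 1))) (by positivity)
  obtain ⟨N, hN⟩ := Metric.tendsto_atTop.1 hσt (ε / 2) (by positivity)
  refine ⟨N, fun k hk => ?_⟩
  have h1 := hN k hk
  rw [Real.dist_eq, sub_zero] at h1 ⊢
  have iρ : Integrable (fun x => h k x * ρ x) μ := hρ.bdd_mul (hm k) (Eventually.of_forall (hC k))
  have iσ : Integrable (fun x => h k x * σ x) μ := hσ.bdd_mul (hm k) (Eventually.of_forall (hC k))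
  have e : ∫ x, h k x * ρ x ∂μ = ∫ x, h k x * σ x ∂μ + ∫ x, h k x * (ρ x - σ x) ∂μ := by
    have iδ : Integrable (fun x => h k x * (ρ x - σ x)) μ :=
      (hρ.sub hσ).bdd_mul (hm k) (Eventually.of_forall (hC k))
    rw [← integral_add iσ iδ]
    exact integral_congr_ae (Eventually.of_forall fun x => by simp only; ring)
  have b : |∫ x, h k x * (ρ x - σ x) ∂μ| ≤ (|C| + 1) * ∫ x, |ρ x - σ x| ∂μ := by
    rw [← integral_const_mul, ← Real.norm_eq_abs]
    refine norm_integral_le_of_norm_le ((hρ.sub hσ).abs.const_mul _)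
      (Eventually.of_forall fun x => ?_)
    rw [Real.norm_eq_abs, abs_mul]
    refine mul_le_mul_of_nonneg_right ?_ (abs_nonneg _)
    linarith [hC k x, le_abs_self C]
  have b' : (|C| + 1) * ∫ x, |ρ x - σ x| ∂μ ≤ ε / 2 := by
    refine (mul_le_mul_of_nonneg_left hσε (by positivity)).trans (le_of_eq ?_)
    have : |C| + 1 ≠ 0 := by positivity
    field_simp
  rw [e]
  linarith [abs_add_le (∫ x, h k x * σ x ∂μ) (∫ x, h k x * (ρ x - σ x) ∂μ)]

theorem tendsto_integral_mul_zero_of_setIntegral (hm : ∀ k, AEStronglyMeasurable (h k) μ)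
    (hC : ∀ k x, |h k x| ≤ C)
    (H : ∀ s, MeasurableSet s → Tendsto (fun k => ∫ x in s, h k x ∂μ) atTop (𝓝 0))
    {ρ : α → ℝ} (hρ : Integrable ρ μ) :
    Tendsto (fun k => ∫ x, h k x * ρ x ∂μ) atTop (𝓝 0) := by
  refine Integrable.induction
    (fun ρ : α → ℝ => Tendsto (fun k => ∫ x, h k x * ρ x ∂μ) atTop (𝓝 0)) ?_ ?_ ?_ ?_ hρ
  · intro c s hs _
    have := (H s hs).mul_const c
    rw [zero_mul] at this
    refine this.congr fun k => ?_
    rw [← integral_mul_const, ← integral_indicator hs]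
    refine integral_congr_ae (Eventually.of_forall fun x => ?_)
    by_cases hx : x ∈ s <;> simp [hx]
  · intro f g _ hf hg h1 h2
    have := h1.add h2
    rw [add_zero] at this
    refine this.congr fun k => ?_
    rw [← integral_add (hf.bdd_mul (hm k) (Eventually.of_forall (hC k)))
      (hg.bdd_mul (hm k) (Eventually.of_forall (hC k)))]
    exact integral_congr_ae (Eventually.of_forall fun x => by simp only [Pi.add_apply]; ring)
  · rw [← isSeqClosed_iff_isClosed]
    intro f g hf hfg
    refine tendsto_integral_mul_zero_of_approx hm hC (L1.integrable_coeFn g) fun ε hε => ?_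
    obtain ⟨N, hN⟩ := Metric.tendsto_atTop.1 hfg ε hε
    refine ⟨f N, L1.integrable_coeFn _, ?_, hf N⟩
    have h1 := (hN N le_rfl).le
    rw [dist_comm, L1.dist_def] at h1
    convert! h1 using 1
    have i1 : Integrable (fun x => |g x - f N x|) μ :=
      ((L1.integrable_coeFn g).sub (L1.integrable_coeFn (f N))).abs
    rw [integral_eq_lintegral_of_nonneg_ae (Eventually.of_forall fun x => abs_nonneg _)
      i1.aestronglyMeasurable]
    congr 1
    refine lintegral_congr fun x => ?_
    rw [edist_dist, Real.dist_eq]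
  · intro f g hfg _ h1
    refine h1.congr fun k => integral_congr_ae ?_
    filter_upwards [hfg] with x hx
    rw [hx]

end WeakStar

/-- A π-λ argument. For disjoint unions, limit and series are exchanged by domination with the
summable terms `C ∫ |v|` over the pieces. -/
theorem tendsto_setIntegral_mul_zero_of_intervals {h : ℕ → ℝ → ℝ} {C a b : ℝ}
    (hab : a ≤ b) (hm : ∀ k, AEStronglyMeasurable (h k) (volume.restrict (Ioc a b)))
    (hC : ∀ k x, |h k x| ≤ C) {v : ℝ → ℝ} (hv : IntegrableOn v (Ioc a b))
    (h0 : ∀ c ∈ Icc a b, Tendsto (fun k => ∫ x in a..c, h k x * v x) atTop (𝓝 0))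
    {s : Set ℝ} (hs : MeasurableSet s) :
    Tendsto (fun k => ∫ x in s, h k x * v x ∂(volume.restrict (Ioc a b))) atTop (𝓝 0) := by
  have hi : ∀ k, IntegrableOn (fun x => h k x * v x) (Ioc a b) := fun k =>
    Integrable.bdd_mul hv (hm k) (Eventually.of_forall (hC k))
  have hbt : Tendsto (fun k => ∫ x in Ioc a b, h k x * v x) atTop (𝓝 0) := by
    simpa only [intervalIntegral.integral_of_le hab] using h0 b ⟨hab, le_rfl⟩
  induction s, hs using MeasurableSpace.induction_on_inter (borel_eq_generateFrom_Iic ℝ)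
    isPiSystem_Iic with
  | empty => simp
  | basic s hs =>
    obtain ⟨c, rfl⟩ := hs
    simp only [Measure.restrict_restrict measurableSet_Iic]
    rcases lt_or_ge c a with h1 | h1
    · have : Iic c ∩ Ioc a b = ∅ := by
        ext x; simp only [mem_inter_iff, mem_Iic, mem_Ioc, mem_empty_iff_false, iff_false]
        rintro ⟨h2, h3, _⟩; linarith
      simp [this]
    · have : Iic c ∩ Ioc a b = Ioc a (min c b) := by
        ext x; simp only [mem_inter_iff, mem_Iic, mem_Ioc, le_min_iff]; tauto
      have h2 := h0 (min c b) ⟨le_min h1 hab, min_le_right _ _⟩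
      simpa only [this, intervalIntegral.integral_of_le (le_min h1 hab)] using h2
  | compl s hs ih =>
    have := hbt.sub ih
    rw [sub_zero] at this
    refine this.congr fun k => ?_
    rw [← integral_add_compl hs (hi k)]
    ring
  | iUnion f hd hf ih =>
    have hsum : Summable fun i => C * ∫ x in f i, |v x| ∂(volume.restrict (Ioc a b)) :=
      ((hasSum_integral_iUnion hf hd (Integrable.abs hv).integrableOn).summable).mul_left C
    have key := tendsto_tsum_of_dominated_convergence
      (f := fun k i => ∫ x in f i, h k x * v x ∂(volume.restrict (Ioc a b)))
      (g := fun _ => 0) (𝓕 := atTop) hsum (fun i => ih i) (Eventually.of_forall fun k i => by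
        rw [← integral_const_mul]
        refine norm_integral_le_of_norm_le ((Integrable.abs hv).integrableOn.const_mul _)
          (Eventually.of_forall fun x => ?_)
        rw [Real.norm_eq_abs, abs_mul]
        exact mul_le_mul_of_nonneg_right (hC k x) (abs_nonneg _))
    rw [tsum_zero] at key
    refine key.congr fun k => ?_
    rw [integral_iUnion hf hd (hi k).integrable.integrableOn]

/-- If a bounded sequence converges weakly against `v 1_[a, b]` for all intervals `[a, b]`, it
converges weakly against all integrable functions vanishing where `v` does. -/
theorem tendsto_setIntegral_mul_zero {I : Set ℝ} (hO : IsOpen I) (hI : I.OrdConnected)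
    {h : ℕ → ℝ → ℝ} {C : ℝ} (hm : ∀ k, AEStronglyMeasurable (h k) (volume.restrict I))
    (hC : ∀ k x, |h k x| ≤ C) {v : ℝ → ℝ} (hv : LocallyIntegrableOn v I volume)
    (h0 : ∀ a ∈ I, ∀ b ∈ I, a ≤ b →
      Tendsto (fun k => ∫ x in a..b, h k x * v x) atTop (𝓝 0))
    {ρ : ℝ → ℝ} (hρ : IntegrableOn ρ I) (hρv : ∀ᵐ x, x ∈ I → v x = 0 → ρ x = 0) :
    Tendsto (fun k => ∫ x in I, h k x * ρ x) atTop (𝓝 0) := by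
  rcases I.eq_empty_or_nonempty with rfl | hne
  · simp
  have hvm : AEStronglyMeasurable v (volume.restrict I) := hv.aestronglyMeasurable
  set w := hvm.mk v with hw
  have hwm : Measurable w := hvm.stronglyMeasurable_mk.measurable
  have hvw : v =ᵐ[volume.restrict I] w := hvm.ae_eq_mk
  obtain ⟨S, hScl, hSI, hSU, hSm⟩ := hO.exists_iUnion_isClosed
  have hK : ∀ n : ℕ, IsCompact (S n ∩ Icc (-(n : ℝ)) n) := fun n =>
    isCompact_Icc.inter_left (hScl n)
  choose a ha b hb hab hsub using fun n => exists_Ioo_of_isCompact hO hne (hK n)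
    (inter_subset_left.trans (hSI n))
  -- Compact pieces of `I`, cut down to where a measurable version `w` of `v` is bounded and bounded
  -- away from zero. They exhaust `{w ≠ 0}` in `I`, which suffices because `ρ` vanishes a.e. where
  -- `v` does.
  set E : ℕ → Set ℝ := fun n => (S n ∩ Icc (-(n : ℝ)) n) ∩ {x | ((n : ℝ) + 1)⁻¹ ≤ |w x| ∧ |w x| ≤ n}
    with hE
  have hEm : ∀ n, MeasurableSet (E n) := fun n => (hK n).measurableSet.inter
    ((measurableSet_le measurable_const hwm.abs).inter (measurableSet_le hwm.abs measurable_const))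
  have hEJ : ∀ n, E n ⊆ Ioc (a n) (b n) := fun n x hx => Ioo_subset_Ioc_self (hsub n hx.1)
  have hJI : ∀ n, Ioc (a n) (b n) ⊆ I := fun n =>
    Ioc_subset_Icc_self.trans (hI.out (ha n) (hb n))
  have hEρ : ∀ n, IntegrableOn (fun x => (E n).indicator ρ x) I := fun n =>
    Integrable.indicator hρ (hEm n)
  have hlim : Tendsto (fun n => ∫ x in I, |ρ x - (E n).indicator ρ x|) atTop (𝓝 0) := by
    have : ∫ _ in I, (0 : ℝ) = 0 := integral_zero _ _
    rw [← this]
    refine tendsto_integral_of_dominated_convergence (fun x => |ρ x|) (fun n =>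
      (Integrable.sub hρ (hEρ n)).abs.aestronglyMeasurable) (Integrable.abs hρ) (fun n =>
      Eventually.of_forall fun x => ?_) ?_
    · by_cases hx : x ∈ E n <;> simp [hx]
    · have hρv' : ∀ᵐ x ∂(volume.restrict I), v x = 0 → ρ x = 0 :=
        (ae_restrict_iff' hO.measurableSet).2 hρv
      filter_upwards [hρv', hvw, ae_restrict_mem hO.measurableSet] with x hx1 hx2 hxI
      by_cases hv0 : v x = 0
      · have hz : ∀ n, |ρ x - (E n).indicator ρ x| = 0 := fun n => by
          by_cases hx : x ∈ E n <;> simp [hx, hx1 hv0]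
        simp only [hz]
        exact tendsto_const_nhds
      · have hwx : 0 < |w x| := abs_pos.2 (by rwa [← hx2])
        rw [← hSU] at hxI
        obtain ⟨m, hm⟩ := mem_iUnion.1 hxI
        have hn : Tendsto (fun n : ℕ => (n : ℝ)) atTop atTop := tendsto_natCast_atTop_atTop
        have ev : ∀ᶠ n : ℕ in atTop, x ∈ E n := by
          filter_upwards [eventually_ge_atTop m, hn.eventually_ge_atTop |x|,
            hn.eventually_ge_atTop |w x|, hn.eventually_ge_atTop |w x|⁻¹] with n h1 h2 h3 h4
          refine ⟨⟨hSm h1 hm, abs_le.1 h2⟩, ?_, h3⟩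
          exact inv_le_of_inv_le₀ hwx (by linarith)
        refine tendsto_const_nhds.congr' ?_
        filter_upwards [ev] with n hn
        simp [hn]
  refine tendsto_integral_mul_zero_of_approx hm hC hρ fun ε hε => ?_
  obtain ⟨n, hn⟩ := (hlim.eventually_le_const hε).exists
  refine ⟨_, hEρ n, hn, ?_⟩
  have hmJ : ∀ k, AEStronglyMeasurable (h k) (volume.restrict (Ioc (a n) (b n))) := fun k =>
    (hm k).mono_measure (Measure.restrict_mono (hJI n) le_rfl)
  have hvwJ : v =ᵐ[volume.restrict (Ioc (a n) (b n))] w :=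
    ae_restrict_of_ae_restrict_of_subset (hJI n) hvw
  have hvJ : IntegrableOn v (Ioc (a n) (b n)) :=
    (hv.integrableOn_compact_subset (hI.out (ha n) (hb n)) isCompact_Icc).mono_set
      Ioc_subset_Icc_self
  -- On `E n` the density factors as `ρ = w · (ρ / w)`. The products `h k · w` are bounded and
  -- converge weakly to zero, while `ρ / w` is integrable.
  have key := tendsto_integral_mul_zero_of_setIntegral
    (μ := volume.restrict (Ioc (a n) (b n))) (C := C * n)
    (h := fun k x => h k x * (E n).indicator w x)
    (fun k => (hmJ k).mul (hwm.indicator (hEm n)).aestronglyMeasurable)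
    (fun k x => by
      rw [abs_mul]
      refine mul_le_mul (hC k x) ?_ (abs_nonneg _) ((abs_nonneg _).trans (hC k x))
      by_cases hx : x ∈ E n
      · simpa [hx] using hx.2.2
      · simp [hx])
    (fun s hs => by
      refine (tendsto_setIntegral_mul_zero_of_intervals (hab n).le hmJ hC hvJ
        (fun c hc => h0 _ (ha n) c (hI.out (ha n) (hb n) hc) hc.1) (hs.inter (hEm n))).congr fun k => ?_
      rw [← setIntegral_indicator (hEm n)]
      refine integral_congr_ae ?_
      filter_upwards [ae_restrict_of_ae hvwJ] with x hx
      by_cases hxE : x ∈ E n <;> simp [hxE, hx])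
    (ρ := fun x => (E n).indicator (fun x => (w x)⁻¹ * ρ x) x) (by
      refine Integrable.mono' (g := fun x => (n + 1) * |ρ x|)
        (((Integrable.abs hρ).mono_measure (Measure.restrict_mono (hJI n) le_rfl)).const_mul _) ?_ ?_
      · refine AEStronglyMeasurable.indicator ?_ (hEm n)
        exact hwm.inv.aestronglyMeasurable.mul (hρ.aestronglyMeasurable.mono_measure
          (Measure.restrict_mono (hJI n) le_rfl))
      · refine Eventually.of_forall fun x => ?_
        by_cases hx : x ∈ E n
        · simp only [hx, indicator_of_mem, norm_mul, norm_inv, Real.norm_eq_abs]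
          refine mul_le_mul_of_nonneg_right ?_ (abs_nonneg _)
          exact inv_le_of_inv_le₀ (by positivity) hx.2.1
        · simp only [hx, not_false_eq_true, indicator_of_notMem, norm_zero]
          positivity)
  refine key.congr fun k => ?_
  have hz : ∀ x, (E n).indicator w x * (E n).indicator (fun x => (w x)⁻¹ * ρ x) x
      = (E n).indicator ρ x := fun x => by
    by_cases hx : x ∈ E n
    · have : w x ≠ 0 := fun h => by
        have := hx.2.1
        rw [h, abs_zero] at this
        have h2 : (0 : ℝ) < ((n : ℝ) + 1)⁻¹ := by positivity
        linarith
      simp only [hx, indicator_of_mem]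
      field_simp
    · simp [hx]
  simp only [mul_assoc, hz]
  refine (setIntegral_eq_of_subset_of_forall_sdiff_eq_zero hO.measurableSet (hJI n)
    fun x hx => ?_).symm
  rw [indicator_of_notMem (fun h => hx.2 (hEJ n h)), mul_zero]

/-! ### Compositions with a bounded measurable function -/

namespace IsPrimitiveOn

variable {I : Set ℝ} {U v : ℝ → ℝ} {Uk vk : ℕ → ℝ → ℝ}

/-- On a compact interval, `∫ (g(U_k) - g(U)) v` equals `∫ g(U_k) v_k - ∫ g(U) v` minus `∫
g(U_k)(v_k - v)`. The first difference tends to zero by the change of variables and continuity of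
the primitive of `g`; the last integral does so by local `L¹` convergence. No continuity of `g` is
needed. -/
theorem tendsto_setIntegral_comp_sub_mul (hO : IsOpen I) (hI : I.OrdConnected)
    (hU : IsPrimitiveOn I U v) (hUk : ∀ k, IsPrimitiveOn I (Uk k) (vk k))
    (hpt : ∀ x ∈ I, Tendsto (fun k => Uk k x) atTop (𝓝 (U x)))
    (hL1 : ∀ a ∈ I, ∀ b ∈ I, a ≤ b →
      Tendsto (fun k => ∫ x in a..b, |vk k x - v x|) atTop (𝓝 0))
    {g : ℝ → ℝ} (hg : Measurable g) {K : ℝ≥0} (hK : ∀ x, |g x| ≤ K)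
    {ρ : ℝ → ℝ} (hρ : IntegrableOn ρ I) (hρv : ∀ᵐ x, x ∈ I → v x = 0 → ρ x = 0) :
    Tendsto (fun k => ∫ x in I, (g (Uk k x) - g (U x)) * ρ x) atTop (𝓝 0) := by
  refine tendsto_setIntegral_mul_zero hO hI (h := fun k x => g (Uk k x) - g (U x))
    (C := 2 * K) (fun k =>
    ((hUk k).aestronglyMeasurable_comp hO hI hg).sub (hU.aestronglyMeasurable_comp hO hI hg))
    (fun k x => ?_) (hU.locallyIntegrableOn hO) (fun a ha b hb hab => ?_) hρ hρv
  · have := abs_sub (g (Uk k x)) (g (U x))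
    linarith [hK (Uk k x), hK (U x)]
  have hΓ := (lipschitzWith_integral hg hK).continuous
  have hint := intervalIntegrable_of_bounded hg hK
  have hdiff : ∀ p q, ∫ t in p..q, g t = (∫ t in (0 : ℝ)..q, g t) - ∫ t in (0 : ℝ)..p, g t :=
    fun p q => (intervalIntegral.integral_interval_sub_left (hint _ _) (hint _ _)).symm
  have t1 : Tendsto (fun k => ∫ t in Uk k a..Uk k b, g t) atTop (𝓝 (∫ t in U a..U b, g t)) := by
    rw [hdiff (U a)]
    exact (((hΓ.tendsto _).comp (hpt b hb)).sub ((hΓ.tendsto _).comp (hpt a ha))).congr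
      fun k => (hdiff _ _).symm
  have hi1 : ∀ k, IntervalIntegrable (fun x => |vk k x - v x|) volume a b := fun k =>
    (((hUk k).sub hU).intervalIntegrable a ha b hb).abs
  have t2 : Tendsto (fun k => ∫ x in a..b, g (Uk k x) * (vk k x - v x)) atTop (𝓝 0) := by
    refine squeeze_zero_norm (fun k => ?_) (by simpa using (hL1 a ha b hb hab).const_mul (K : ℝ))
    rw [← intervalIntegral.integral_const_mul]
    refine intervalIntegral.norm_integral_le_of_norm_le hab (Eventually.of_forall fun x _ => ?_)
      ((hi1 k).const_mul _)
    rw [Real.norm_eq_abs, abs_mul]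
    exact mul_le_mul_of_nonneg_right (hK _) (abs_nonneg _)
  have t3 := (t1.sub_const (∫ t in U a..U b, g t)).sub t2
  rw [sub_self, sub_zero] at t3
  refine t3.congr fun k => ?_
  have i1 := (hUk k).intervalIntegrable_comp_mul hO hI hg hK ha hb
  have i2 := hU.intervalIntegrable_comp_mul hO hI hg hK ha hb
  have i3 : IntervalIntegrable (fun x => g (Uk k x) * (vk k x - v x)) volume a b :=
    intervalIntegrable_mul_of_bounded (((hUk k).aestronglyMeasurable_comp hO hI hg).mono_measure
      (Measure.restrict_mono (uIoc_subset_uIcc.trans (hI.uIcc_subset ha hb)) le_rfl))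
      (fun x => hK _) (((hUk k).sub hU).intervalIntegrable a ha b hb)
  rw [← (hUk k).integral_comp_mul hO hI hg hK ha hb, ← hU.integral_comp_mul hO hI hg hK ha hb,
    ← intervalIntegral.integral_sub i1 i2, ← intervalIntegral.integral_sub (i1.sub i2) i3]
  exact intervalIntegral.integral_congr fun x _ => by ring

/-- Weak convergence of both `g(U_k)` and its square gives convergence in `L²(ρ)`, and then in
`L¹(ρ)` because `ρ` has finite mass. -/
theorem tendsto_setIntegral_abs_comp_sub_mul (hO : IsOpen I) (hI : I.OrdConnected)
    (hU : IsPrimitiveOn I U v) (hUk : ∀ k, IsPrimitiveOn I (Uk k) (vk k))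
    (hpt : ∀ x ∈ I, Tendsto (fun k => Uk k x) atTop (𝓝 (U x)))
    (hL1 : ∀ a ∈ I, ∀ b ∈ I, a ≤ b →
      Tendsto (fun k => ∫ x in a..b, |vk k x - v x|) atTop (𝓝 0))
    {g : ℝ → ℝ} (hg : Measurable g) {K : ℝ≥0} (hK : ∀ x, |g x| ≤ K)
    {ρ : ℝ → ℝ} (hρ : IntegrableOn ρ I) (hρ0 : ∀ x, 0 ≤ ρ x)
    (hρv : ∀ᵐ x, x ∈ I → v x = 0 → ρ x = 0) :
    Tendsto (fun k => ∫ x in I, |g (Uk k x) - g (U x)| * ρ x) atTop (𝓝 0) := by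
  have hgU := hU.aestronglyMeasurable_comp hO hI hg
  have hgUk := fun k => (hUk k).aestronglyMeasurable_comp hO hI hg
  have hb : ∀ k x, |g (Uk k x) - g (U x)| ≤ 2 * K := fun k x => by
    have := abs_sub (g (Uk k x)) (g (U x))
    linarith [hK (Uk k x), hK (U x)]
  have hgρ : IntegrableOn (fun x => g (U x) * ρ x) I :=
    Integrable.bdd_mul hρ hgU (Eventually.of_forall fun x => hK _)
  have a1 := tendsto_setIntegral_comp_sub_mul hO hI hU hUk hpt hL1 hg hK hgρ
    (hρv.mono fun x hx h1 h2 => by rw [hx h1 h2, mul_zero])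
  have hK2 : ∀ x, |g x ^ 2| ≤ ((K ^ 2 : ℝ≥0) : ℝ) := fun x => by
    rw [abs_pow, NNReal.coe_pow]
    exact pow_le_pow_left₀ (abs_nonneg _) (hK x) 2
  have a2 := tendsto_setIntegral_comp_sub_mul hO hI hU hUk hpt hL1 (hg.pow_const 2) hK2 hρ hρv
  -- With `p = g(U_k)` and `q = g(U)`, use `(p - q)² = (p² - q²) - 2 q (p - q)`; the factor `q` is
  -- absorbed into the density, as in `a1`.
  have hD : Tendsto (fun k => ∫ x in I, (g (Uk k x) - g (U x)) ^ 2 * ρ x) atTop (𝓝 0) := by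
    have := a2.sub (a1.const_mul 2)
    rw [mul_zero, sub_zero] at this
    refine this.congr fun k => ?_
    rw [← integral_const_mul, ← integral_sub]
    · exact integral_congr_ae (Eventually.of_forall fun x => by simp only; ring)
    · refine Integrable.bdd_mul (c := 2 * (K : ℝ) ^ 2) hρ
        (((hUk k).aestronglyMeasurable_comp hO hI (hg.pow_const 2)).sub
          (hU.aestronglyMeasurable_comp hO hI (hg.pow_const 2)))
        (Eventually.of_forall fun x => ?_)
      have h1 := hK2 (Uk k x)
      have h2 := hK2 (U x)
      rw [NNReal.coe_pow] at h1 h2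
      rw [Real.norm_eq_abs]
      have := abs_sub (g (Uk k x) ^ 2) (g (U x) ^ 2)
      linarith
    · exact (Integrable.bdd_mul hgρ ((hgUk k).sub hgU)
        (Eventually.of_forall fun x => hb k x)).const_mul 2
  rw [Metric.tendsto_atTop]
  intro ε hε
  have hρi : 0 ≤ ∫ x in I, ρ x := integral_nonneg hρ0
  set δ := ε / (2 * ((∫ x in I, ρ x) + 1)) with hδ
  have hδ0 : 0 < δ := by positivity
  obtain ⟨N, hN⟩ := Metric.tendsto_atTop.1 hD (δ * (ε / 2)) (by positivity)
  refine ⟨N, fun k hk => ?_⟩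
  have h1 := hN k hk
  rw [Real.dist_eq, sub_zero] at h1 ⊢
  rw [abs_of_nonneg (integral_nonneg fun x => mul_nonneg (abs_nonneg _) (hρ0 x))]
  have i1 : IntegrableOn (fun x => |g (Uk k x) - g (U x)| * ρ x) I :=
    Integrable.bdd_mul (c := 2 * (K : ℝ)) hρ ((hgUk k).sub hgU).norm
      (Eventually.of_forall fun x => by
        simpa only [Real.norm_eq_abs, abs_abs] using hb k x)
  have i2 : IntegrableOn (fun x => (g (Uk k x) - g (U x)) ^ 2 * ρ x) I := by
    refine Integrable.bdd_mul (c := (2 * (K : ℝ)) ^ 2) hρ (((hgUk k).sub hgU).pow 2)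
      (Eventually.of_forall fun x => ?_)
    rw [norm_pow]
    exact pow_le_pow_left₀ (norm_nonneg _) (hb k x) 2
  have h2 : ∫ x in I, |g (Uk k x) - g (U x)| * ρ x
      ≤ δ * (∫ x in I, ρ x) + δ⁻¹ * ∫ x in I, (g (Uk k x) - g (U x)) ^ 2 * ρ x := by
    rw [← integral_const_mul, ← integral_const_mul, ← integral_add (hρ.const_mul _)
      (i2.const_mul _)]
    refine integral_mono i1 ((hρ.const_mul _).add (i2.const_mul _)) fun x => ?_
    simp only
    rw [← mul_assoc, ← add_mul]
    refine mul_le_mul_of_nonneg_right ?_ (hρ0 x)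
    rw [← sq_abs]
    set d := |g (Uk k x) - g (U x)|
    -- Completing the square proves `d ≤ δ + d² / δ`, which replaces Cauchy-Schwarz.
    have e : δ + δ⁻¹ * d ^ 2 - d = δ⁻¹ * ((d - δ / 2) ^ 2 + 3 / 4 * δ ^ 2) := by
      field_simp; ring
    have : 0 ≤ δ⁻¹ * ((d - δ / 2) ^ 2 + 3 / 4 * δ ^ 2) := by positivity
    linarith
  have h3 : δ * (∫ x in I, ρ x) ≤ ε / 2 := by
    rw [hδ, div_mul_eq_mul_div, div_le_div_iff₀ (by positivity) (by positivity)]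
    nlinarith
  have h4 : δ⁻¹ * ∫ x in I, (g (Uk k x) - g (U x)) ^ 2 * ρ x < ε / 2 := by
    rw [inv_mul_lt_iff₀ hδ0]
    exact (le_abs_self _).trans_lt h1
  linarith

end IsPrimitiveOn

/-! ### Young functions -/

namespace IsYoung

variable {A : ℝ≥0 → ℝ≥0∞}

theorem map_mul_le (hA : IsYoung A) {θ : ℝ≥0} (hθ : θ ≤ 1) (t : ℝ≥0) : A (θ * t) ≤ θ * A t := by
  have h := hA.convex.2 (mem_univ t) (mem_univ 0) (zero_le : 0 ≤ θ) (zero_le : 0 ≤ 1 - θ)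
    (add_tsub_cancel_of_le hθ)
  simpa [hA.zero, ENNReal.smul_def] using h

theorem mono (hA : IsYoung A) : Monotone A := by
  intro s t hst
  rcases eq_or_ne t 0 with rfl | ht
  · rw [nonpos_iff_eq_zero.1 hst]
  · have h1 : s / t ≤ 1 := div_le_one_of_le₀ hst zero_le
    have h2 := hA.map_mul_le h1 t
    rw [div_mul_cancel₀ s ht] at h2
    exact h2.trans (mul_le_of_le_one_left zero_le (by exact_mod_cast h1))

theorem measurable (hA : IsYoung A) : Measurable A := hA.mono.measurable

theorem map_add_le (hA : IsYoung A) (s t : ℝ≥0) : A (s + t) ≤ A (2 * s) + A (2 * t) := by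
  have h := hA.convex.2 (mem_univ (2 * s)) (mem_univ (2 * t)) (zero_le : (0 : ℝ≥0) ≤ 1 / 2)
    (zero_le : (0 : ℝ≥0) ≤ 1 / 2) (by norm_num)
  have e : (1 / 2 : ℝ≥0) • (2 * s) + (1 / 2 : ℝ≥0) • (2 * t) = s + t := by
    simp only [smul_eq_mul]
    field_simp
  rw [e] at h
  refine h.trans (add_le_add ?_ ?_) <;>
  · rw [ENNReal.smul_def, smul_eq_mul]
    refine mul_le_of_le_one_left zero_le ?_
    exact_mod_cast (by norm_num : (1 / 2 : ℝ≥0) ≤ 1)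

theorem exists_pos_lt_top (hA : IsYoung A) : ∃ s : ℝ≥0, 0 < s ∧ A s < ⊤ := by
  obtain ⟨s, t, hs, ht, hne⟩ := hA.nonconst
  by_cases h : A s = ⊤
  · exact ⟨t, ht, lt_top_iff_ne_top.2 fun h' => hne (h.trans h'.symm)⟩
  · exact ⟨s, hs, lt_top_iff_ne_top.2 h⟩

/-- By convexity and `A 0 = 0`, `A t / t` is nondecreasing, so beyond a small `r` with `A r`
positive and finite, `t` is at most a multiple of `A t`. Below `r ≤ ε` the additive term suffices.
-/
theorem le_add_mul (hA : IsYoung A) (hA' : IsNondegenerate A) {ε : ℝ≥0} (hε : 0 < ε) :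
    ∃ C : ℝ≥0, ∀ t : ℝ≥0, (t : ℝ≥0∞) ≤ ε + C * A t := by
  obtain ⟨s, hs, hst⟩ := hA.exists_pos_lt_top
  set r := min ε s with hr
  have hr0 : 0 < r := lt_min hε hs
  have hAr : A r < ⊤ := (hA.mono (min_le_right _ _)).trans_lt hst
  have hAr0 : 0 < A r := hA' r hr0
  obtain ⟨m, hm⟩ : ∃ m : ℝ≥0, (m : ℝ≥0∞) = A r := ⟨_, ENNReal.coe_toNNReal hAr.ne⟩
  have hm0 : 0 < m := by rw [← hm] at hAr0; exact_mod_cast hAr0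
  refine ⟨r / m, fun t => ?_⟩
  rcases le_or_gt t r with h | h
  · refine le_add_right ?_
    exact_mod_cast h.trans (min_le_left _ _)
  · refine le_add_left ?_
    have ht0 : 0 < t := hr0.trans h
    have h1 : r / t ≤ 1 := div_le_one_of_le₀ h.le zero_le
    have h2 := hA.map_mul_le h1 t
    rw [div_mul_cancel₀ r ht0.ne', ← hm] at h2
    have h3 : ((t / r : ℝ≥0) : ℝ≥0∞) * m ≤ A t := by
      calc ((t / r : ℝ≥0) : ℝ≥0∞) * m ≤ ((t / r : ℝ≥0) : ℝ≥0∞) * (((r / t : ℝ≥0) : ℝ≥0∞) * A t) := by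
            gcongr
        _ = A t := by
            rw [← mul_assoc, ← ENNReal.coe_mul, div_mul_div_cancel₀ hr0.ne', div_self ht0.ne']
            simp
    calc (t : ℝ≥0∞) = ((r / m : ℝ≥0) : ℝ≥0∞) * (((t / r : ℝ≥0) : ℝ≥0∞) * m) := by
          rw [← ENNReal.coe_mul, ← ENNReal.coe_mul]
          congr 1
          field_simp
      _ ≤ _ := by gcongr

/-- Linear behaviour near zero removes the additive error, which is what allows `L¹` control on sets
of infinite measure. Convexity carries the bound to large `t`. -/
theorem le_mul_of_equivNearZero (hA : IsYoung A)
    (h : EquivNearZero A (fun t => (t : ℝ≥0∞))) : ∃ C : ℝ≥0, ∀ t : ℝ≥0, (t : ℝ≥0∞) ≤ C * A t := by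
  obtain ⟨c, hc, t₀, ht₀, H⟩ := h
  refine ⟨c, fun t => ?_⟩
  have key : ∀ s : ℝ≥0, s ≤ c * t₀ → (s : ℝ≥0∞) ≤ c * A s := by
    intro s hs
    have h1 := (H (s / c) (by rw [div_le_iff₀ hc, mul_comm]; exact hs)).2
    rw [mul_div_cancel₀ s hc.ne'] at h1
    calc (s : ℝ≥0∞) = c * ((s / c : ℝ≥0) : ℝ≥0∞) := by
          rw [← ENNReal.coe_mul, mul_div_cancel₀ s hc.ne']
      _ ≤ _ := by gcongr
  rcases le_or_gt t (c * t₀) with h | h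
  · exact key t h
  · have hr0 : 0 < c * t₀ := mul_pos hc ht₀
    have ht0 : 0 < t := hr0.trans h
    have h1 : c * t₀ / t ≤ 1 := div_le_one_of_le₀ h.le zero_le
    have h2 := hA.map_mul_le h1 t
    rw [div_mul_cancel₀ _ ht0.ne'] at h2
    have h3 := (key (c * t₀) le_rfl).trans (mul_le_mul_right h2 (c : ℝ≥0∞))
    calc (t : ℝ≥0∞) = ((t / (c * t₀) : ℝ≥0) : ℝ≥0∞) * ((c * t₀ : ℝ≥0) : ℝ≥0∞) := by
          rw [← ENNReal.coe_mul, div_mul_cancel₀ _ hr0.ne']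
      _ ≤ ((t / (c * t₀) : ℝ≥0) : ℝ≥0∞) * (c * (((c * t₀ / t : ℝ≥0) : ℝ≥0∞) * A t)) := by gcongr
      _ = c * A t := by
          rw [mul_left_comm, ← mul_assoc (((t / (c * t₀) : ℝ≥0) : ℝ≥0∞)), ← ENNReal.coe_mul,
            div_mul_div_cancel₀ hr0.ne', div_self ht0.ne']
          simp

end IsYoung

/-- `A` controls the `L¹` norm on sets of measure at most `L`, up to arbitrarily small errors. -/
def DominatesL1 (A : ℝ≥0 → ℝ≥0∞) (L : ℝ≥0∞) : Prop :=
  ∀ δ : ℝ≥0, 0 < δ → ∃ ε C : ℝ≥0, ε * L ≤ δ ∧ ∀ t : ℝ≥0, (t : ℝ≥0∞) ≤ ε + C * A t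

theorem IsYoung.dominatesL1 {A : ℝ≥0 → ℝ≥0∞} (hA : IsYoung A) (hA' : IsNondegenerate A)
    (L : ℝ≥0) : DominatesL1 A L := by
  intro δ hδ
  obtain ⟨C, hC⟩ := hA.le_add_mul hA' (ε := δ / (L + 1)) (by positivity)
  refine ⟨_, C, ?_, hC⟩
  rw [← ENNReal.coe_mul, ENNReal.coe_le_coe, div_mul_eq_mul_div, div_le_iff₀ (by positivity)]
  exact mul_le_mul_right (le_add_of_nonneg_right zero_le) δ

theorem IsYoung.dominatesL1_top {A : ℝ≥0 → ℝ≥0∞} (hA : IsYoung A)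
    (h : EquivNearZero A (fun t => (t : ℝ≥0∞))) : DominatesL1 A ⊤ := by
  intro δ _
  obtain ⟨C, hC⟩ := hA.le_mul_of_equivNearZero h
  exact ⟨0, C, by simp, by simpa using hC⟩

/-! ### Modulars -/

section Modular

variable {A : ℝ≥0 → ℝ≥0∞} {I : Set ℝ} {l : ℝ≥0}

theorem modular_congr_ae (hO : IsOpen I) {u w : ℝ → ℝ} (h : ∀ᵐ x, x ∈ I → u x = w x) :
    modular A I l u = modular A I l w := by
  refine setLIntegral_congr_fun_ae hO.measurableSet ?_
  filter_upwards [h] with x hx hxI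
  rw [hx hxI]

theorem modular_mono (hA : IsYoung A) (hO : IsOpen I) {l' K : ℝ≥0} (hl : 0 < l) (hl' : K * l ≤ l')
    {u w : ℝ → ℝ} (h : ∀ᵐ x, x ∈ I → |w x| ≤ K * |u x|) :
    modular A I l' w ≤ modular A I l u := by
  refine setLIntegral_mono_ae' hO.measurableSet ?_
  filter_upwards [h] with x hx hxI
  have h1 : ‖w x‖₊ ≤ K * ‖u x‖₊ := by
    rw [← NNReal.coe_le_coe]
    simpa using hx hxI
  refine hA.mono ?_
  -- When `l' = 0`, division by zero returns zero and the inequality is trivial.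
  rcases eq_or_ne l' 0 with h0 | h0
  · rw [h0, div_zero]; exact zero_le
  rw [div_le_div_iff₀ (pos_iff_ne_zero.2 h0) hl]
  calc ‖w x‖₊ * l ≤ K * ‖u x‖₊ * l := by gcongr
    _ = ‖u x‖₊ * (K * l) := by ring
    _ ≤ _ := by gcongr

theorem lintegral_enorm_le_modular (hl : 0 < l) {ε C : ℝ≥0}
    (h : ∀ t : ℝ≥0, (t : ℝ≥0∞) ≤ ε + C * A t) {S : Set ℝ} (hS : S ⊆ I) (w : ℝ → ℝ) :
    ∫⁻ x in S, ‖w x‖ₑ ≤ l * (ε * volume S + C * modular A I l w) := by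
  calc ∫⁻ x in S, ‖w x‖ₑ ≤ ∫⁻ x in S, l * (ε + C * A (‖w x‖₊ / l)) := by
        refine lintegral_mono fun x => ?_
        calc ‖w x‖ₑ = l * ((‖w x‖₊ / l : ℝ≥0) : ℝ≥0∞) := by
              rw [← ENNReal.coe_mul, mul_div_cancel₀ _ hl.ne']; rfl
          _ ≤ _ := by gcongr; exact h _
    _ = l * (ε * volume S + C * modular A S l w) := by
        rw [lintegral_const_mul' _ _ ENNReal.coe_ne_top, lintegral_add_left measurable_const,
          lintegral_const_mul' _ _ ENNReal.coe_ne_top, setLIntegral_const]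
        rfl
    _ ≤ _ := by
        gcongr
        exact lintegral_mono_set hS

theorem DominatesL1.exists_lintegral_le {L : ℝ≥0∞} (hAL : DominatesL1 A L) (hl : 0 < l)
    {w : ℝ → ℝ} (hw : modular A I l w < ⊤) :
    ∃ B : ℝ≥0, ∀ S ⊆ I, volume S ≤ L → ∫⁻ x in S, ‖w x‖ₑ ≤ B := by
  obtain ⟨ε, C, hε, hC⟩ := hAL 1 one_pos
  lift modular A I l w to ℝ≥0 using hw.ne with m hm
  refine ⟨l * (1 + C * m), fun S hS hSL => (lintegral_enorm_le_modular hl hC hS w).trans ?_⟩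
  rw [← hm]
  push_cast
  gcongr
  exact (mul_le_mul_right hSL _).trans hε

theorem DominatesL1.eventually_lintegral_le {L : ℝ≥0∞} (hAL : DominatesL1 A L) (hl : 0 < l)
    {w : ℕ → ℝ → ℝ} (hw : Tendsto (fun k => modular A I l (w k)) atTop (𝓝 0)) {δ : ℝ≥0}
    (hδ : 0 < δ) :
    ∀ᶠ k in atTop, ∀ S ⊆ I, volume S ≤ L → ∫⁻ x in S, ‖w k x‖ₑ ≤ δ := by
  obtain ⟨ε, C, hε, hC⟩ := hAL (δ / (2 * l)) (by positivity)
  have h1 : Tendsto (fun k => C * modular A I l (w k)) atTop (𝓝 0) := by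
    simpa using ENNReal.Tendsto.const_mul hw (Or.inr (ENNReal.coe_ne_top (r := C)))
  have h2 : (0 : ℝ≥0∞) < ((δ / (2 * l) : ℝ≥0) : ℝ≥0∞) := by
    exact_mod_cast (by positivity : 0 < δ / (2 * l))
  filter_upwards [h1.eventually_le_const h2] with k hk S hS hSL
  refine (lintegral_enorm_le_modular hl hC hS (w k)).trans ?_
  calc (l : ℝ≥0∞) * (ε * volume S + C * modular A I l (w k))
      ≤ l * (((δ / (2 * l) : ℝ≥0) : ℝ≥0∞) + ((δ / (2 * l) : ℝ≥0) : ℝ≥0∞)) := by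
        gcongr
        exact (mul_le_mul_right hSL _).trans hε
    _ = δ := by
        rw [← ENNReal.coe_add, ← ENNReal.coe_mul]
        congr 1
        field_simp
        norm_num

theorem tendsto_intervalIntegral_abs_of_modular (hA : IsYoung A) (hA' : IsNondegenerate A)
    (hI : I.OrdConnected) (hl : 0 < l) {w : ℕ → ℝ → ℝ}
    (hw : Tendsto (fun k => modular A I l (w k)) atTop (𝓝 0))
    {a b : ℝ} (ha : a ∈ I) (hb : b ∈ I) (hab : a ≤ b)
    (hi : ∀ k, IntervalIntegrable (w k) volume a b) :
    Tendsto (fun k => ∫ x in a..b, |w k x|) atTop (𝓝 0) := by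
  rw [Metric.tendsto_atTop']
  intro ε hε
  lift ε to ℝ≥0 using hε.le
  have hε' : 0 < ε / 2 := by
    have : 0 < ε := by exact_mod_cast hε
    positivity
  obtain ⟨N, hN⟩ := eventually_atTop.1
    ((hA.dominatesL1 hA' (b - a).toNNReal).eventually_lintegral_le hl hw hε')
  refine ⟨N, fun k hk => ?_⟩
  have h1 := hN k hk.le (Ioc a b) (Ioc_subset_Icc_self.trans (hI.out ha hb)) (by
    rw [Real.volume_Ioc]; rfl)
  have h2 : ∫ x in a..b, |w k x| = (∫⁻ x in Ioc a b, ‖w k x‖ₑ).toReal := by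
    rw [intervalIntegral.integral_of_le hab]
    exact integral_norm_eq_lintegral_enorm (hi k).1.aestronglyMeasurable
  rw [Real.dist_eq, sub_zero, h2, abs_of_nonneg ENNReal.toReal_nonneg]
  have h3 := ENNReal.toReal_mono ENNReal.coe_ne_top h1
  rw [ENNReal.coe_toReal, NNReal.coe_div, NNReal.coe_ofNat] at h3
  linarith

end Modular

/-! ### Modular convergence of `g(u_k) u_k'` -/

/-- The core estimate. Splitting the sum inside `A` costs a factor 2 in the argument, which accounts
for `2 * K * l`. The second term carries a further 2 from `|g(U_k) - g(U)| ≤ 2K`, which accounts for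
`4 * K * l₀`. -/
theorem IsPrimitiveOn.tendsto_modular_comp_mul {A : ℝ≥0 → ℝ≥0∞} (hA : IsYoung A)
    (hA' : IsNondegenerate A) {I : Set ℝ} (hO : IsOpen I) (hI : I.OrdConnected)
    {U v : ℝ → ℝ} {Uk vk : ℕ → ℝ → ℝ} (hU : IsPrimitiveOn I U v)
    (hUk : ∀ k, IsPrimitiveOn I (Uk k) (vk k))
    (hpt : ∀ x ∈ I, Tendsto (fun k => Uk k x) atTop (𝓝 (U x)))
    {l l₀ : ℝ≥0} (hl : 0 < l) (hl₀ : 0 < l₀)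
    (hvk : Tendsto (fun k => modular A I l (fun x => vk k x - v x)) atTop (𝓝 0))
    (hv : modular A I l₀ v < ⊤) {g : ℝ → ℝ} (hg : Measurable g) {K : ℝ≥0} (hK0 : 0 < K)
    (hK : ∀ x, |g x| ≤ K) {m : ℝ≥0} (hm1 : 2 * K * l ≤ m) (hm2 : 4 * K * l₀ ≤ m) :
    Tendsto (fun k => modular A I m (fun x => g (Uk k x) * vk k x - g (U x) * v x))
      atTop (𝓝 0) := by
  have hmeasv : AEMeasurable v (volume.restrict I) :=
    (hU.locallyIntegrableOn hO).aestronglyMeasurable.aemeasurable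
  have hmeasvk : ∀ k, AEMeasurable (vk k) (volume.restrict I) := fun k =>
    ((hUk k).locallyIntegrableOn hO).aestronglyMeasurable.aemeasurable
  have hAv : AEMeasurable (fun x => A (‖v x‖₊ / l₀)) (volume.restrict I) :=
    hA.measurable.comp_aemeasurable (hmeasv.nnnorm.div_const l₀)
  set ρ : ℝ → ℝ := fun x => (A (‖v x‖₊ / l₀)).toReal with hρ
  have hρi : IntegrableOn ρ I := integrable_toReal_of_lintegral_ne_top hAv hv.ne
  have hρ0 : ∀ x, 0 ≤ ρ x := fun x => ENNReal.toReal_nonneg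
  have hlim := tendsto_setIntegral_abs_comp_sub_mul hO hI hU hUk hpt
    (fun a ha b hb hab => tendsto_intervalIntegral_abs_of_modular hA hA' hI hl hvk ha hb hab
      fun k => ((hUk k).sub hU).intervalIntegrable a ha b hb) hg hK hρi hρ0
    (Eventually.of_forall fun x _ h0 => by simp [hρ, h0, hA.zero])
  -- Normalised to lie in `[0, 1]`, so that convexity pulls it out of `A` as a linear factor.
  set θ : ℕ → ℝ → ℝ≥0 := fun k x => ‖g (Uk k x) - g (U x)‖₊ / (2 * K) with hθ
  have hθ1 : ∀ k x, θ k x ≤ 1 := fun k x => by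
    refine div_le_one_of_le₀ ?_ zero_le
    rw [← NNReal.coe_le_coe]
    have := abs_sub (g (Uk k x)) (g (U x))
    simp only [coe_nnnorm, Real.norm_eq_abs, NNReal.coe_mul, NNReal.coe_ofNat]
    linarith [hK (Uk k x), hK (U x)]
  have hsecond : Tendsto (fun k => ∫⁻ x in I, θ k x * A (‖v x‖₊ / l₀)) atTop (𝓝 0) := by
    have h1 := ENNReal.tendsto_ofReal (hlim.const_mul (2 * (K : ℝ))⁻¹)
    rw [mul_zero, ENNReal.ofReal_zero] at h1
    refine h1.congr fun k => ?_
    have i1 : IntegrableOn (fun x => |g (Uk k x) - g (U x)| * ρ x) I :=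
      Integrable.bdd_mul (c := 2 * (K : ℝ)) hρi
        (((hUk k).aestronglyMeasurable_comp hO hI hg).sub
          (hU.aestronglyMeasurable_comp hO hI hg)).norm (Eventually.of_forall fun x => by
          have := abs_sub (g (Uk k x)) (g (U x))
          rw [Real.norm_eq_abs, abs_abs]
          exact this.trans (by linarith [hK (Uk k x), hK (U x)]))
    rw [← integral_const_mul, ofReal_integral_eq_lintegral_ofReal (i1.const_mul _)
      (Eventually.of_forall fun x => by
        have := hρ0 x
        positivity)]
    refine lintegral_congr_ae ?_
    filter_upwards [ae_lt_top' hAv hv.ne] with x hx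
    rw [← mul_assoc, ENNReal.ofReal_mul (by positivity), ENNReal.ofReal_toReal hx.ne]
    congr 1
    rw [← ENNReal.ofReal_coe_nnreal]
    congr 1
    simp only [hθ, NNReal.coe_div, coe_nnnorm, Real.norm_eq_abs, NNReal.coe_mul, NNReal.coe_ofNat]
    rw [inv_mul_eq_div]
  have hsum := hvk.add hsecond
  rw [add_zero] at hsum
  refine tendsto_of_tendsto_of_tendsto_of_le_of_le tendsto_const_nhds hsum (fun k => zero_le)
    fun k => ?_
  have hmeas1 : AEMeasurable (fun x => A (‖vk k x - v x‖₊ / l)) (volume.restrict I) :=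
    hA.measurable.comp_aemeasurable (((hmeasvk k).sub hmeasv).nnnorm.div_const l)
  simp only [modular]
  rw [← lintegral_add_left' hmeas1]
  refine lintegral_mono fun x => ?_
  have hm0 : 0 < m := lt_of_lt_of_le (by positivity) hm1
  have hb : ‖g (Uk k x) * vk k x - g (U x) * v x‖₊
      ≤ K * ‖vk k x - v x‖₊ + 2 * K * θ k x * ‖v x‖₊ := by
    have e : g (Uk k x) * vk k x - g (U x) * v x
        = g (Uk k x) * (vk k x - v x) + (g (Uk k x) - g (U x)) * v x := by ring
    rw [e]
    refine (nnnorm_add_le _ _).trans ?_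
    rw [nnnorm_mul, nnnorm_mul]
    refine add_le_add (mul_le_mul_left ?_ _) (le_of_eq ?_)
    · rw [← NNReal.coe_le_coe]
      exact hK _
    · rw [hθ]
      simp only
      rw [mul_div_cancel₀ _ (by positivity)]
  calc A (‖g (Uk k x) * vk k x - g (U x) * v x‖₊ / m)
      ≤ A (K * ‖vk k x - v x‖₊ / m + 2 * K * θ k x * ‖v x‖₊ / m) := by
        refine hA.mono ?_
        rw [← add_div]
        gcongr
    _ ≤ A (2 * (K * ‖vk k x - v x‖₊ / m)) + A (2 * (2 * K * θ k x * ‖v x‖₊ / m)) :=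
        hA.map_add_le _ _
    _ ≤ A (‖vk k x - v x‖₊ / l) + A (θ k x * (‖v x‖₊ / l₀)) := by
        refine add_le_add (hA.mono ?_) (hA.mono ?_)
        · rw [← mul_div_assoc, div_le_div_iff₀ hm0 hl]
          calc 2 * (K * ‖vk k x - v x‖₊) * l = ‖vk k x - v x‖₊ * (2 * K * l) := by ring
            _ ≤ _ := by gcongr
        · rw [← mul_div_assoc, ← mul_div_assoc (θ k x), div_le_div_iff₀ hm0 hl₀]
          calc 2 * (2 * K * θ k x * ‖v x‖₊) * l₀ = θ k x * ‖v x‖₊ * (4 * K * l₀) := by ring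
            _ ≤ _ := by gcongr
    _ ≤ _ := by
        gcongr
        exact hA.map_mul_le (hθ1 k x) _

/-! ### Uniform estimates for primitives -/

theorem IsPrimitiveOn.enorm_le {I : Set ℝ} {W w : ℝ → ℝ} (h : IsPrimitiveOn I W w) {x y : ℝ}
    (hx : x ∈ I) (hy : y ∈ I) {S : Set ℝ} (hS : uIoc y x ⊆ S) :
    ‖W x‖ₑ ≤ ‖W y‖ₑ + ∫⁻ t in S, ‖w t‖ₑ := by
  have e : W x = W y + ∫ t in y..x, w t := by rw [← h.sub_eq y hy x hx]; ring
  have h1 : ‖∫ t in y..x, w t‖ₑ ≤ ∫⁻ t in S, ‖w t‖ₑ := by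
    have h2 : ‖∫ t in y..x, w t‖ₑ = ‖∫ t in uIoc y x, w t‖ₑ := by
      rw [← enorm_norm, intervalIntegral.norm_intervalIntegral_eq, enorm_norm]
    rw [h2]
    exact (enorm_integral_le_lintegral_enorm _).trans (lintegral_mono_set hS)
  rw [e]
  exact (enorm_add_le _ _).trans (by gcongr)

/-- From any point of the interval, move a fixed distance towards a reference point `y` and, if
necessary, past it within a neighbourhood of `y` contained in `I`. The uniform length makes local
bounds uniform even on unbounded `I`. -/
theorem exists_length_Icc_subset {I : Set ℝ} (hO : IsOpen I) (hI : I.OrdConnected)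
    (hne : I.Nonempty) :
    ∃ ℓ : ℝ≥0, 0 < ℓ ∧ ∀ x ∈ I, ∃ c : ℝ, x ∈ Icc c (c + ℓ) ∧ Icc c (c + ℓ) ⊆ I := by
  obtain ⟨y, hy⟩ := hne
  obtain ⟨δ, hδ, hs⟩ := exists_Icc_nhds_subset hO hy
  lift δ to ℝ≥0 using hδ.le
  refine ⟨δ, by exact_mod_cast hδ, fun x hx => ?_⟩
  rcases le_or_gt x y with h | h
  · refine ⟨x, ⟨le_rfl, by simp⟩, fun z hz => ?_⟩
    refine hI.out hx (hs (show y + δ ∈ _ from ⟨by linarith, le_rfl⟩)) ⟨hz.1, ?_⟩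
    linarith [hz.2]
  · refine ⟨x - δ, ⟨by linarith, by simp⟩, fun z hz => ?_⟩
    refine hI.out (hs (show y - δ ∈ _ from ⟨le_rfl, by linarith⟩)) hx ⟨?_, ?_⟩
    · linarith [hz.1]
    · linarith [hz.2]

/-- Average the bound `|W x| ≤ |W y| + B` over all `y` in the interval. -/
theorem IsPrimitiveOn.mul_enorm_le {I : Set ℝ} {W w : ℝ → ℝ} (h : IsPrimitiveOn I W w) {c : ℝ}
    {ℓ : ℝ≥0} {x : ℝ} (hx : x ∈ Icc c (c + ℓ)) (hI : Icc c (c + ℓ) ⊆ I) {B : ℝ≥0∞}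
    (hW : ∫⁻ t in Icc c (c + ℓ), ‖W t‖ₑ ≤ B) (hw : ∫⁻ t in Icc c (c + ℓ), ‖w t‖ₑ ≤ B) :
    ℓ * ‖W x‖ₑ ≤ (1 + ℓ) * B := by
  have hvol : volume (Icc c (c + ℓ)) = ℓ := by
    rw [Real.volume_Icc, add_sub_cancel_left, ENNReal.ofReal_coe_nnreal]
  calc ℓ * ‖W x‖ₑ = ∫⁻ _ in Icc c (c + ℓ), ‖W x‖ₑ := by
        rw [setLIntegral_const, hvol, mul_comm]
    _ ≤ ∫⁻ y in Icc c (c + ℓ), (‖W y‖ₑ + B) := by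
        refine setLIntegral_mono' measurableSet_Icc fun y hy => ?_
        exact (h.enorm_le (hI hx) (hI hy)
          (uIoc_subset_uIcc.trans (ordConnected_Icc.uIcc_subset hy hx))).trans (by gcongr)
    _ = (∫⁻ y in Icc c (c + ℓ), ‖W y‖ₑ) + ℓ * B := by
        rw [lintegral_add_right _ measurable_const, setLIntegral_const, hvol, mul_comm]
    _ ≤ B + ℓ * B := by gcongr
    _ = _ := by ring

theorem le_of_coe_mul_enorm_le {ℓ δ : ℝ≥0} (hℓ : 0 < ℓ) {y : ℝ}
    (h : ℓ * ‖y‖ₑ ≤ (1 + ℓ) * (δ : ℝ≥0∞)) : |y| ≤ (1 + ℓ) * δ / ℓ := by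
  have h1 : ℓ * ‖y‖₊ ≤ (1 + ℓ) * δ := by
    rw [enorm_eq_nnnorm] at h
    exact_mod_cast h
  have h2 : (ℓ : ℝ) * |y| ≤ (1 + ℓ) * δ := by exact_mod_cast h1
  rw [le_div_iff₀ (by exact_mod_cast hℓ)]
  linarith

section SupBounds

variable {A : ℝ≥0 → ℝ≥0∞} {I : Set ℝ}

theorem IsPrimitiveOn.exists_bound_of_modular (hA : IsYoung A) (hA' : IsNondegenerate A)
    (hO : IsOpen I) (hI : I.OrdConnected) {W w : ℝ → ℝ} (h : IsPrimitiveOn I W w) {l l' : ℝ≥0}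
    (hl : 0 < l) (hl' : 0 < l') (hW : modular A I l W < ⊤) (hw : modular A I l' w < ⊤) :
    ∃ M : ℝ, ∀ x ∈ I, |W x| ≤ M := by
  rcases I.eq_empty_or_nonempty with rfl | hne
  · exact ⟨0, by simp⟩
  obtain ⟨ℓ, hℓ, hJ⟩ := exists_length_Icc_subset hO hI hne
  obtain ⟨B, hB⟩ := (hA.dominatesL1 hA' ℓ).exists_lintegral_le hl hW
  obtain ⟨B', hB'⟩ := (hA.dominatesL1 hA' ℓ).exists_lintegral_le hl' hw
  refine ⟨(1 + ℓ) * (max B B' : ℝ≥0) / ℓ, fun x hx => ?_⟩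
  obtain ⟨c, hc, hcI⟩ := hJ x hx
  have hvol : volume (Icc c (c + ℓ)) ≤ ℓ := by
    rw [Real.volume_Icc, add_sub_cancel_left, ENNReal.ofReal_coe_nnreal]
  exact le_of_coe_mul_enorm_le hℓ (h.mul_enorm_le hc hcI
    ((hB _ hcI hvol).trans (by exact_mod_cast le_max_left _ _))
    ((hB' _ hcI hvol).trans (by exact_mod_cast le_max_right _ _)))

theorem IsPrimitiveOn.eventually_abs_le_of_modular (hA : IsYoung A) (hA' : IsNondegenerate A)
    (hO : IsOpen I) (hI : I.OrdConnected) {W w : ℕ → ℝ → ℝ}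
    (h : ∀ k, IsPrimitiveOn I (W k) (w k)) {l : ℝ≥0} (hl : 0 < l)
    (hW : Tendsto (fun k => modular A I l (W k)) atTop (𝓝 0))
    (hw : Tendsto (fun k => modular A I l (w k)) atTop (𝓝 0)) {δ : ℝ} (hδ : 0 < δ) :
    ∀ᶠ k in atTop, ∀ x ∈ I, |W k x| ≤ δ := by
  rcases I.eq_empty_or_nonempty with rfl | hne
  · simp
  obtain ⟨ℓ, hℓ, hJ⟩ := exists_length_Icc_subset hO hI hne
  lift δ to ℝ≥0 using hδ.le
  have hδ' : 0 < ℓ * δ / (1 + ℓ) := by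
    have : 0 < δ := by exact_mod_cast hδ
    positivity
  filter_upwards [(hA.dominatesL1 hA' ℓ).eventually_lintegral_le hl hW hδ',
    (hA.dominatesL1 hA' ℓ).eventually_lintegral_le hl hw hδ'] with k h1 h2 x hx
  obtain ⟨c, hc, hcI⟩ := hJ x hx
  have hvol : volume (Icc c (c + ℓ)) ≤ ℓ := by
    rw [Real.volume_Icc, add_sub_cancel_left, ENNReal.ofReal_coe_nnreal]
  refine (le_of_coe_mul_enorm_le hℓ ((h k).mul_enorm_le hc hcI (h1 _ hcI hvol)
    (h2 _ hcI hvol))).trans (le_of_eq ?_)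
  have : (0 : ℝ) < ℓ := by exact_mod_cast hℓ
  push_cast
  field_simp

/-- A bound by the derivative alone needs a point where `W` is zero or small. For bounded `Ω` it is
a point outside a ball containing `Ω`; otherwise, superlevel sets of finite measure cannot fill the
line, so `|W|` takes arbitrarily small values. In the second case `S` is the whole line, whence the
need for `DominatesL1 A ⊤`. -/
theorem exists_enorm_le_lintegral_deriv (hA : IsYoung A) (hA' : IsNondegenerate A) {Ω : Set ℝ}
    (h : Bornology.IsBounded Ω ∨ EquivNearZero A (fun t => (t : ℝ≥0∞))) :
    ∃ (S : Set ℝ) (L : ℝ≥0∞), DominatesL1 A L ∧ volume S ≤ L ∧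
      ∀ W w : ℝ → ℝ, IsPrimitiveOn univ W w → (∀ᵐ x, x ∉ Ω → W x = 0) →
        (∀ t : ℝ, 0 < t → volume {x | t < |W x|} < ⊤) → ∀ x, ‖W x‖ₑ ≤ ∫⁻ t in S, ‖w t‖ₑ := by
  rcases h with h | h
  · obtain ⟨R, hR⟩ := h.subset_closedBall 0
    rw [Real.closedBall_eq_Icc, zero_sub, zero_add] at hR
    refine ⟨Icc (-(|R| + 1)) (|R| + 1), _, hA.dominatesL1 hA' (2 * (|R| + 1)).toNNReal, ?_, ?_⟩
    · rw [Real.volume_Icc]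
      exact le_of_eq (congrArg ENNReal.ofReal (by ring))
    intro W w hW h0 _ x
    have hout : ∀ y ∈ (Icc (-R) R)ᶜ, W y = 0 := by
      refine Measure.eqOn_open_of_ae_eq (μ := volume) ?_ isClosed_Icc.isOpen_compl
        ((hW.continuousOn isOpen_univ ordConnected_univ).mono (subset_univ _))
        continuousOn_const
      refine (ae_restrict_iff' isClosed_Icc.isOpen_compl.measurableSet).2 ?_
      filter_upwards [h0] with y hy hyR using hy fun hyΩ => hyR (hR hyΩ)
    have hR' := le_abs_self R
    by_cases hx : x ∈ Icc (-R) R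
    · have h1 := hW.enorm_le (mem_univ x) (mem_univ (-(|R| + 1)))
        (S := Icc (-(|R| + 1)) (|R| + 1)) (uIoc_subset_uIcc.trans (ordConnected_Icc.uIcc_subset
          ⟨le_rfl, by linarith [abs_nonneg R]⟩ ⟨by linarith [hx.1], by linarith [hx.2]⟩))
      rwa [hout (-(|R| + 1)) (fun h => by linarith [h.1]), enorm_zero, zero_add] at h1
    · rw [hout x hx, enorm_zero]
      exact zero_le
  · refine ⟨univ, ⊤, hA.dominatesL1_top h, le_top, fun W w hW _ hfin x => ?_⟩
    refine ENNReal.le_of_forall_pos_le_add fun t ht _ => ?_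
    obtain ⟨y, hy⟩ : ∃ y, |W y| ≤ t := by
      by_contra hcon
      push Not at hcon
      have := hfin t (by exact_mod_cast ht)
      rw [show {x | (t : ℝ) < |W x|} = univ from eq_univ_of_forall hcon] at this
      simp at this
    refine (hW.enorm_le (mem_univ x) (mem_univ y) (subset_univ _)).trans ?_
    rw [add_comm]
    gcongr
    rw [enorm_eq_nnnorm, ENNReal.coe_le_coe, ← NNReal.coe_le_coe]
    exact hy

end SupBounds

/-! ### Composition with a locally Lipschitz function -/

theorem exists_lipschitzWith_eq {f : ℝ → ℝ} (hf : LocallyLipschitz f) (M : ℝ) :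
    ∃ (F : ℝ → ℝ) (K : ℝ≥0), 0 < K ∧ LipschitzWith K F ∧ ∀ y, |y| ≤ M → f y = F y := by
  obtain ⟨K, hK⟩ := (hf.locallyLipschitzOn (s := Icc (-M) M)).exists_lipschitzOnWith_of_compact
    isCompact_Icc
  obtain ⟨F, hF, hFf⟩ := hK.extend_real
  exact ⟨F, K + 1, by positivity, hF.weaken (le_add_of_nonneg_right zero_le),
    fun y hy => hFf (abs_le.1 hy)⟩

theorem exists_isWeakDeriv_compOp {f : ℝ → ℝ} (hf : LocallyLipschitz f)
    {I : Set ℝ} (hO : IsOpen I) (hI : I.OrdConnected) {u v : ℝ → ℝ} (hu : IsWeakDeriv I u v)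
    {M : ℝ} (hM : ∀ᵐ x, x ∈ I → |u x| ≤ M) :
    ∃ K : ℝ≥0, 0 < K ∧ (∃ w, IsWeakDeriv I (compOp f u) w ∧ ∀ᵐ x, x ∈ I → |w x| ≤ K * |v x|) ∧
      ∀ᵐ x, x ∈ I → |compOp f u x - f 0| ≤ K * |u x| := by
  obtain ⟨U, hU, huU⟩ := hu.exists_primitive hO hI
  -- Using `|M|` ensures that `F` also agrees with `f` at 0.
  obtain ⟨F, K, hK0, hF, hfF⟩ := exists_lipschitzWith_eq hf |M|
  refine ⟨K, hK0, ⟨fun x => deriv F (U x) * v x,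
    (hU.lipschitz_comp hO hI hF).isWeakDeriv hO hI ?_, Eventually.of_forall fun x _ => ?_⟩, ?_⟩
  · filter_upwards [huU, hM] with x h1 h2 hxI
    rw [← h1 hxI]
    exact hfF _ ((h2 hxI).trans (le_abs_self M))
  · rw [abs_mul]
    exact mul_le_mul_of_nonneg_right (norm_deriv_le_of_lipschitz hF) (abs_nonneg _)
  · filter_upwards [hM] with x h2 hxI
    rw [compOp, hfF _ ((h2 hxI).trans (le_abs_self M)), hfF 0 (by simp)]
    simpa [Real.dist_eq] using hF.dist_le_mul (u x) 0

/-- Common to both spaces: uniform convergence confines `U_k`, for large `k`, to a range where `f`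
equals a Lipschitz `F`. The remaining finitely many `k` only need some weak derivative of the
composition, which `hw` supplies; a.e. uniqueness identifies it with `F'(U_k) v_k` for large `k`. -/
theorem exists_tendsto_compOp {f : ℝ → ℝ} (hf : LocallyLipschitz f)
    {A : ℝ≥0 → ℝ≥0∞} (hA : IsYoung A) (hA' : IsNondegenerate A)
    {I : Set ℝ} (hO : IsOpen I) (hI : I.OrdConnected)
    {u U v : ℝ → ℝ} {uk Uk vk : ℕ → ℝ → ℝ} (hU : IsPrimitiveOn I U v)
    (hUk : ∀ k, IsPrimitiveOn I (Uk k) (vk k)) (hu : ∀ᵐ x, x ∈ I → u x = U x)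
    (huk : ∀ k, ∀ᵐ x, x ∈ I → uk k x = Uk k x) {M : ℝ} (hM : ∀ x ∈ I, |U x| ≤ M)
    (hunif : ∀ δ : ℝ, 0 < δ → ∀ᶠ k in atTop, ∀ x ∈ I, |Uk k x - U x| ≤ δ)
    {l l₀ : ℝ≥0} (hl : 0 < l) (hl₀ : 0 < l₀) (hvk : ModularTendstoWith A I l vk v)
    (hv : modular A I l₀ v < ⊤) (hw : ∀ k, ∃ w, IsWeakDeriv I (compOp f (uk k)) w) :
    ∃ K : ℝ≥0, 0 < K ∧
      (∀ᶠ k in atTop, ∀ᵐ x, x ∈ I → |compOp f (uk k) x - compOp f u x| ≤ K * |uk k x - u x|) ∧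
      ∃ (w : ℕ → ℝ → ℝ) (w₀ : ℝ → ℝ), (∀ k, IsWeakDeriv I (compOp f (uk k)) (w k)) ∧
        IsWeakDeriv I (compOp f u) w₀ ∧ ∃ m₀ : ℝ≥0, 0 < m₀ ∧ ∀ m, m₀ ≤ m →
          ModularTendstoWith A I m w w₀ := by
  -- The margin 1 accommodates `U_k` once it is uniformly within 1 of `U`.
  obtain ⟨F, K, hK0, hF, hfF⟩ := exists_lipschitzWith_eq hf (M + 1)
  choose w hw using hw
  have hUb : ∀ x ∈ I, f (U x) = F (U x) := fun x hx => hfF _ (by linarith [hM x hx])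
  have hUkb : ∀ᶠ k in atTop, ∀ x ∈ I, f (Uk k x) = F (Uk k x) := by
    filter_upwards [hunif 1 one_pos] with k hk x hx
    refine hfF _ ?_
    have := abs_add_le (Uk k x - U x) (U x)
    rw [sub_add_cancel] at this
    linarith [hk x hx, hM x hx]
  have hpt : ∀ x ∈ I, Tendsto (fun k => Uk k x) atTop (𝓝 (U x)) := fun x hx => by
    rw [Metric.tendsto_nhds]
    intro ε hε
    filter_upwards [hunif (ε / 2) (by positivity)] with k hk
    rw [Real.dist_eq]
    linarith [hk x hx]
  refine ⟨K, hK0, ?_, w, fun x => deriv F (U x) * v x, hw,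
    (hU.lipschitz_comp hO hI hF).isWeakDeriv hO hI ?_, 2 * K * l + 4 * K * l₀, by positivity,
    fun m hm => ?_⟩
  · filter_upwards [hUkb] with k hk
    filter_upwards [hu, huk k] with x h1 h2 hxI
    simp only [compOp]
    rw [h1 hxI, h2 hxI, hk x hxI, hUb x hxI]
    simpa [Real.dist_eq] using hF.dist_le_mul (Uk k x) (U x)
  · filter_upwards [hu] with x h1 hxI
    rw [compOp, h1 hxI, hUb x hxI]
  · have key := IsPrimitiveOn.tendsto_modular_comp_mul hA hA' hO hI hU hUk hpt hl hl₀ hvk hv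
      (measurable_deriv F) hK0 (fun x => norm_deriv_le_of_lipschitz hF)
      ((le_add_of_nonneg_right zero_le).trans hm) ((le_add_of_nonneg_left zero_le).trans hm)
    refine key.congr' ?_
    filter_upwards [hUkb] with k hk
    refine modular_congr_ae hO ?_
    have h1 : IsWeakDeriv I (compOp f (uk k)) (fun x => deriv F (Uk k x) * vk k x) := by
      refine ((hUk k).lipschitz_comp hO hI hF).isWeakDeriv hO hI ?_
      filter_upwards [huk k] with x h1 hxI
      rw [compOp, h1 hxI, hk x hxI]
    filter_upwards [(ae_restrict_iff' hO.measurableSet).1 (h1.ae_unique hO (hw k))] with x hx hxI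
    rw [hx hxI]

/-! ### The operator on `W^{1,A}` -/

section W1

variable {A : ℝ≥0 → ℝ≥0∞} {Ω : Set ℝ} {f : ℝ → ℝ}

theorem IsWeakDeriv.mem_orliczSpace_of_abs_le (hA : IsYoung A) (hO : IsOpen Ω) {u v w : ℝ → ℝ}
    (hw : IsWeakDeriv Ω u w) {K : ℝ≥0} (hK : 0 < K) (hv : v ∈ OrliczSpace A Ω)
    (h : ∀ᵐ x, x ∈ Ω → |w x| ≤ K * |v x|) : w ∈ OrliczSpace A Ω := by
  obtain ⟨_, l, hl, hlt⟩ := hv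
  exact ⟨hw.locInt_deriv.aestronglyMeasurable.aemeasurable, K * l, by positivity,
    (modular_mono hA hO hl le_rfl h).trans_lt hlt⟩

theorem exists_bound_of_mem_W1 (hA : IsYoung A) (hA' : IsNondegenerate A) (hO : IsOpen Ω)
    (hI : Ω.OrdConnected) {u U v : ℝ → ℝ} (hu : u ∈ OrliczSpace A Ω) (hv : v ∈ OrliczSpace A Ω)
    (hU : IsPrimitiveOn Ω U v) (huU : ∀ᵐ x, x ∈ Ω → u x = U x) :
    ∃ M : ℝ, ∀ x ∈ Ω, |U x| ≤ M := by
  obtain ⟨_, l, hl, hlt⟩ := hu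
  obtain ⟨_, l', hl', hlt'⟩ := hv
  rw [modular_congr_ae hO huU] at hlt
  exact hU.exists_bound_of_modular hA hA' hO hI hl hl' hlt hlt'

theorem orliczSpace_congr_ae (hO : IsOpen Ω) {v w : ℝ → ℝ} (hv : v ∈ OrliczSpace A Ω)
    (h : ∀ᵐ x ∂(volume.restrict Ω), v x = w x) : w ∈ OrliczSpace A Ω := by
  obtain ⟨hm, l, hl, hlt⟩ := hv
  refine ⟨hm.congr h, l, hl, ?_⟩
  rwa [← modular_congr_ae hO ((ae_restrict_iff' hO.measurableSet).1 h)]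

theorem compOp_mem_orliczSpace_of_isBounded (hA : IsYoung A) (hO : IsOpen Ω)
    (hΩ : Bornology.IsBounded Ω) (hf : Continuous f) {u : ℝ → ℝ}
    (hu : AEMeasurable u (volume.restrict Ω)) {B : ℝ≥0}
    (hB : ∀ᵐ x, x ∈ Ω → |compOp f u x| ≤ B) : compOp f u ∈ OrliczSpace A Ω := by
  obtain ⟨s, hs, hst⟩ := hA.exists_pos_lt_top
  refine ⟨hf.measurable.comp_aemeasurable hu, (B + 1) / s, by positivity, ?_⟩
  calc modular A Ω ((B + 1) / s) (compOp f u) ≤ ∫⁻ _ in Ω, A s := by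
        refine setLIntegral_mono_ae' hO.measurableSet ?_
        filter_upwards [hB] with x hx hxΩ
        refine hA.mono ?_
        have h1 : ‖compOp f u x‖₊ ≤ B := by
          rw [← NNReal.coe_le_coe]
          exact hx hxΩ
        rw [div_div_eq_mul_div, div_le_iff₀ (by positivity), mul_comm s]
        exact mul_le_mul_left (h1.trans (le_add_of_nonneg_right zero_le)) s
    _ = A s * volume Ω := setLIntegral_const _ _
    _ < ⊤ := ENNReal.mul_lt_top hst hΩ.measure_lt_top

theorem mapsTo_compOp_W1 (hA : IsYoung A) (hA' : IsNondegenerate A) (hO : IsOpen Ω)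
    (hI : Ω.OrdConnected) (hf : LocallyLipschitz f) (h : Bornology.IsBounded Ω ∨ f 0 = 0) :
    MapsTo (compOp f) (W1 A Ω) (W1 A Ω) := by
  rintro u ⟨hu, v, huv, hv⟩
  obtain ⟨U, hU, huU⟩ := huv.exists_primitive hO hI
  obtain ⟨M, hM⟩ := exists_bound_of_mem_W1 hA hA' hO hI hu hv hU huU
  have hMu : ∀ᵐ x, x ∈ Ω → |u x| ≤ M := by
    filter_upwards [huU] with x hx hxI
    rw [hx hxI]
    exact hM x hxI
  obtain ⟨K, hK, ⟨w, hw, hwv⟩, hfu⟩ := exists_isWeakDeriv_compOp hf hO hI huv hMu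
  refine ⟨?_, w, hw, hw.mem_orliczSpace_of_abs_le hA hO hK hv hwv⟩
  rcases h with h | h
  · refine compOp_mem_orliczSpace_of_isBounded hA hO h hf.continuous hu.1
      (B := ‖f 0‖₊ + K * ‖M‖₊) ?_
    filter_upwards [hfu, hMu] with x h1 h2 hxI
    have h3 := abs_add_le (compOp f u x - f 0) (f 0)
    rw [sub_add_cancel] at h3
    have h4 : K * |u x| ≤ K * |M| :=
      mul_le_mul_of_nonneg_left ((h2 hxI).trans (le_abs_self M)) K.2
    push_cast
    rw [Real.norm_eq_abs, Real.norm_eq_abs]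
    linarith [h1 hxI]
  · obtain ⟨hm, l, hl, hlt⟩ := hu
    refine ⟨hf.continuous.measurable.comp_aemeasurable hm, K * l, by positivity,
      (modular_mono hA hO hl le_rfl ?_).trans_lt hlt⟩
    filter_upwards [hfu] with x h1 hxI
    simpa [h] using h1 hxI

theorem isModularlyContinuous_compOp_W1 (hA : IsYoung A) (hA' : IsNondegenerate A)
    (hO : IsOpen Ω) (hI : Ω.OrdConnected) (hf : LocallyLipschitz f)
    (h : Bornology.IsBounded Ω ∨ f 0 = 0) :
    IsModularlyContinuous (W1 A Ω) (W1ModularTendsto A Ω) (compOp f) := by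
  have hmap := mapsTo_compOp_W1 hA hA' hO hI hf h
  refine ⟨hmap, ?_⟩
  rintro uk u huk ⟨hu, v', huv', hv'⟩ ⟨vk, v, hvk, huv, l, hl, hul, hvl⟩
  have hv := orliczSpace_congr_ae hO hv' (huv'.ae_unique hO huv)
  obtain ⟨U, hU, huU⟩ := huv.exists_primitive hO hI
  choose Uk hUk hukUk using fun k => (hvk k).exists_primitive hO hI
  obtain ⟨M, hM⟩ := exists_bound_of_mem_W1 hA hA' hO hI hu hv hU huU
  have hUl : Tendsto (fun k => modular A Ω l (fun x => Uk k x - U x)) atTop (𝓝 0) := by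
    refine hul.congr fun k => modular_congr_ae hO ?_
    filter_upwards [huU, hukUk k] with x h1 h2 hxI
    rw [h1 hxI, h2 hxI]
  obtain ⟨_, l₀, hl₀, hlt⟩ := hv
  obtain ⟨K, hK, hfK, w, w₀, hw, hw₀, m₀, hm₀, hm⟩ := exists_tendsto_compOp hf hA hA' hO hI hU hUk
    huU hukUk hM (fun δ hδ => IsPrimitiveOn.eventually_abs_le_of_modular hA hA' hO hI
      (fun k => (hUk k).sub hU) hl hUl hvl hδ) hl hl₀ hvl hlt
    (fun k => (hmap (huk k)).2.imp fun _ h => h.1)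
  -- A single constant must serve both limits: `K * l` for the functions by the Lipschitz bound,
  -- `m₀` for the derivatives.
  refine ⟨w, w₀, hw, hw₀, max m₀ (K * l), lt_max_of_lt_left hm₀, ?_, hm _ (le_max_left _ _)⟩
  refine tendsto_of_tendsto_of_tendsto_of_le_of_le' tendsto_const_nhds hul
    (Eventually.of_forall fun k => zero_le) ?_
  filter_upwards [hfK] with k hk using modular_mono hA hO hl (le_max_right _ _) hk

end W1

/-! ### The operator on `V^{1,A}_0` -/

section V10

variable {A : ℝ≥0 → ℝ≥0∞} {Ω : Set ℝ} {f : ℝ → ℝ}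

theorem indicator_compOp (h0 : f 0 = 0) (Ω : Set ℝ) (u : ℝ → ℝ) :
    Ω.indicator (compOp f u) = compOp f (Ω.indicator u) := by
  ext x
  by_cases hx : x ∈ Ω <;> simp [compOp, hx, h0]

theorem volume_superlevel_lt_top_congr {u U : ℝ → ℝ} (h : ∀ᵐ x, x ∈ univ → u x = U x)
    (hu : ∀ t : ℝ, 0 < t → volume {x | t < |u x|} < ⊤) (t : ℝ) (ht : 0 < t) :
    volume {x | t < |U x|} < ⊤ := by
  refine lt_of_eq_of_lt (measure_congr ?_) (hu t ht)
  filter_upwards [h] with x hx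
  exact propext (show t < |U x| ↔ t < |u x| by rw [hx trivial])

theorem volume_superlevel_sub_lt_top {U W : ℝ → ℝ}
    (hU : ∀ t : ℝ, 0 < t → volume {x | t < |U x|} < ⊤)
    (hW : ∀ t : ℝ, 0 < t → volume {x | t < |W x|} < ⊤) (t : ℝ) (ht : 0 < t) :
    volume {x | t < |U x - W x|} < ⊤ := by
  refine lt_of_le_of_lt (measure_mono (t := {x | t / 2 < |U x|} ∪ {x | t / 2 < |W x|}) ?_)
    (measure_union_lt_top (hU _ (by positivity)) (hW _ (by positivity)))
  intro x hx
  by_contra hcon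
  simp only [mem_union, not_or] at hcon
  have h1 : |U x| ≤ t / 2 := not_lt.1 hcon.1
  have h2 : |W x| ≤ t / 2 := not_lt.1 hcon.2
  have h3 : t < |U x - W x| := hx
  linarith [abs_sub (U x) (W x)]

theorem ae_eq_zero_of_indicator {u U : ℝ → ℝ}
    (h : ∀ᵐ x, x ∈ univ → Ω.indicator u x = U x) : ∀ᵐ x, x ∉ Ω → U x = 0 := by
  filter_upwards [h] with x hx hxΩ
  rw [← hx trivial, indicator_of_notMem hxΩ]

theorem modular_univ_eq_of_ae_eq_zero (hA : IsYoung A) (hO : IsOpen Ω) (l : ℝ≥0) {w : ℝ → ℝ}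
    (h : ∀ᵐ x, x ∉ Ω → w x = 0) : modular A univ l w = modular A Ω l w := by
  simp only [modular, setLIntegral_univ]
  rw [← lintegral_indicator hO.measurableSet]
  refine lintegral_congr_ae ?_
  filter_upwards [h] with x hx
  by_cases hxΩ : x ∈ Ω
  · rw [indicator_of_mem hxΩ]
  · rw [indicator_of_notMem hxΩ, hx hxΩ]
    simp [hA.zero]

/-- The derivative of `U` vanishes a.e. on the level set `{U = 0}`, even when the complement of `Ω`
has no special structure. Thus modulars of derivatives over `Ω` and over the line agree, and `V10`
can be treated entirely on `univ`. -/
theorem IsPrimitiveOn.ae_deriv_eq_zero {U v : ℝ → ℝ} (hU : IsPrimitiveOn univ U v)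
    (h : ∀ᵐ x, x ∉ Ω → U x = 0) : ∀ᵐ x, x ∉ Ω → v x = 0 := by
  filter_upwards [h, hU.ae_eq_zero_of_comp_mem_null isOpen_univ ordConnected_univ
    (N := {0}) (by simp)] with x h1 h2 hx
  exact h2 trivial (h1 hx)

theorem IsWeakDeriv.ae_eq_zero_of_indicator {u v : ℝ → ℝ}
    (h : IsWeakDeriv univ (Ω.indicator u) v) : ∀ᵐ x, x ∉ Ω → v x = 0 := by
  obtain ⟨U, hU, huU⟩ := h.exists_primitive isOpen_univ ordConnected_univ
  exact hU.ae_deriv_eq_zero (OrliczSobolev.ae_eq_zero_of_indicator huU)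

theorem modularTendstoWith_univ_iff (hA : IsYoung A) (hO : IsOpen Ω) {l : ℝ≥0}
    {uk vk : ℕ → ℝ → ℝ} {u v : ℝ → ℝ} (hvk : ∀ k, IsWeakDeriv univ (Ω.indicator (uk k)) (vk k))
    (hv : IsWeakDeriv univ (Ω.indicator u) v) :
    ModularTendstoWith A univ l vk v ↔ ModularTendstoWith A Ω l vk v := by
  refine tendsto_congr fun k => modular_univ_eq_of_ae_eq_zero hA hO l ?_
  filter_upwards [(hvk k).ae_eq_zero_of_indicator, hv.ae_eq_zero_of_indicator] with x h1 h2 hx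
  rw [h1 hx, h2 hx, sub_zero]

theorem exists_bound_of_mem_V10 (hA : IsYoung A) (hA' : IsNondegenerate A)
    (h : Bornology.IsBounded Ω ∨ EquivNearZero A (fun t => (t : ℝ≥0∞))) {u U v : ℝ → ℝ}
    (hu : ∀ t : ℝ, 0 < t → volume {x | t < |Ω.indicator u x|} < ⊤)
    (hv : v ∈ OrliczSpace A univ) (hU : IsPrimitiveOn univ U v)
    (huU : ∀ᵐ x, x ∈ univ → Ω.indicator u x = U x) : ∃ M : ℝ, ∀ x ∈ univ, |U x| ≤ M := by
  obtain ⟨S, L, hL, hSL, H⟩ := exists_enorm_le_lintegral_deriv hA hA' h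
  obtain ⟨_, l, hl, hlt⟩ := hv
  obtain ⟨B, hB⟩ := hL.exists_lintegral_le hl hlt
  refine ⟨B, fun x _ => ?_⟩
  have h1 := (H U v hU (ae_eq_zero_of_indicator huU) (volume_superlevel_lt_top_congr huU hu) x).trans
    (hB S (subset_univ _) hSL)
  rw [enorm_eq_nnnorm, ENNReal.coe_le_coe, ← NNReal.coe_le_coe] at h1
  exact h1

theorem mapsTo_compOp_V10 (hA : IsYoung A) (hA' : IsNondegenerate A) (hf : LocallyLipschitz f)
    (h0 : f 0 = 0) (h : Bornology.IsBounded Ω ∨ EquivNearZero A (fun t => (t : ℝ≥0∞))) :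
    MapsTo (compOp f) (V10 A Ω) (V10 A Ω) := by
  rintro u ⟨hm, ⟨v, huv, hv⟩, hu⟩
  obtain ⟨U, hU, huU⟩ := huv.exists_primitive isOpen_univ ordConnected_univ
  obtain ⟨M, hM⟩ := exists_bound_of_mem_V10 hA hA' h hu hv hU huU
  have hMu : ∀ᵐ x, x ∈ univ → |Ω.indicator u x| ≤ M := by
    filter_upwards [huU] with x hx hxI
    rw [hx hxI]
    exact hM x hxI
  obtain ⟨K, hK, ⟨w, hw, hwv⟩, hfu⟩ :=
    exists_isWeakDeriv_compOp hf isOpen_univ ordConnected_univ huv hMu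
  refine ⟨hf.continuous.measurable.comp_aemeasurable hm, ⟨w, ?_,
    hw.mem_orliczSpace_of_abs_le hA isOpen_univ hK hv hwv⟩, fun t ht => ?_⟩
  · rwa [indicator_compOp h0]
  · have hK' : (0 : ℝ) < K := by exact_mod_cast hK
    rw [indicator_compOp h0]
    refine lt_of_le_of_lt (measure_mono_ae ?_) (hu (t / K) (by positivity))
    filter_upwards [hfu] with x hx hxt
    have h1 := hx trivial
    rw [h0, sub_zero] at h1
    have h2 : t < |compOp f (Ω.indicator u) x| := hxt
    change t / K < |Ω.indicator u x|
    rw [div_lt_iff₀ hK']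
    linarith

theorem isModularlyContinuous_compOp_V10 (hA : IsYoung A) (hA' : IsNondegenerate A)
    (hO : IsOpen Ω)
    (hf : LocallyLipschitz f) (h0 : f 0 = 0)
    (h : Bornology.IsBounded Ω ∨ EquivNearZero A (fun t => (t : ℝ≥0∞))) :
    IsModularlyContinuous (V10 A Ω) (V10ModularTendsto A Ω) (compOp f) := by
  have hmap := mapsTo_compOp_V10 (Ω := Ω) hA hA' hf h0 h
  refine ⟨hmap, ?_⟩
  rintro uk u huk ⟨hm, ⟨v', huv', hv'⟩, hu⟩ ⟨vk, v, hvk, huv, l, hl, hvl⟩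
  rw [← modularTendstoWith_univ_iff hA hO hvk huv] at hvl
  have hv := orliczSpace_congr_ae isOpen_univ hv' (huv'.ae_unique isOpen_univ huv)
  obtain ⟨U, hU, huU⟩ := huv.exists_primitive isOpen_univ ordConnected_univ
  choose Uk hUk hukUk using fun k => (hvk k).exists_primitive isOpen_univ ordConnected_univ
  obtain ⟨M, hM⟩ := exists_bound_of_mem_V10 hA hA' h hu hv hU huU
  obtain ⟨S, L, hL, hSL, H⟩ := exists_enorm_le_lintegral_deriv hA hA' h
  have hunif : ∀ δ : ℝ, 0 < δ → ∀ᶠ k in atTop, ∀ x ∈ univ, |Uk k x - U x| ≤ δ := by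
    intro δ hδ
    lift δ to ℝ≥0 using hδ.le
    filter_upwards [hL.eventually_lintegral_le hl hvl (by exact_mod_cast hδ)] with k hk x _
    have h1 := (H _ _ ((hUk k).sub hU) (by
      filter_upwards [ae_eq_zero_of_indicator (hukUk k), ae_eq_zero_of_indicator huU]
        with x h1 h2 hx
      rw [h1 hx, h2 hx, sub_zero])
      (volume_superlevel_sub_lt_top (volume_superlevel_lt_top_congr (hukUk k) (huk k).2.2)
        (volume_superlevel_lt_top_congr huU hu)) x).trans (hk S (subset_univ _) hSL)
    rw [enorm_eq_nnnorm, ENNReal.coe_le_coe, ← NNReal.coe_le_coe] at h1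
    exact h1
  obtain ⟨_, l₀, hl₀, hlt⟩ := hv
  obtain ⟨K, hK, -, w, w₀, hw, hw₀, m₀, hm₀, hmt⟩ := exists_tendsto_compOp hf hA hA' isOpen_univ
    ordConnected_univ hU hUk huU hukUk hM hunif hl hl₀ hvl hlt (fun k => by
      obtain ⟨w, hw, _⟩ := (hmap (huk k)).2.1
      rw [indicator_compOp h0] at hw
      exact ⟨w, hw⟩)
  have hw' : ∀ k, IsWeakDeriv univ (Ω.indicator (compOp f (uk k))) (w k) := fun k => by
    rw [indicator_compOp h0]
    exact hw k
  have hw₀' : IsWeakDeriv univ (Ω.indicator (compOp f u)) w₀ := by rwa [indicator_compOp h0]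
  exact ⟨w, w₀, hw', hw₀', m₀, hm₀,
    (modularTendstoWith_univ_iff hA hO hw' hw₀').1 (hmt m₀ le_rfl)⟩

end V10

end OrliczSobolev

theorem mainTheorem9 (Ω : Set ℝ) (hΩ_open : IsOpen Ω) (hΩ_interval : Ω.OrdConnected)
    (A : ℝ≥0 → ℝ≥0∞) (hA : OrliczSobolev.IsYoung A) (hA_nondeg : OrliczSobolev.IsNondegenerate A)
    (f : ℝ → ℝ) (hf : LocallyLipschitz f) :
    (Bornology.IsBounded Ω ∨ f 0 = 0 →
      OrliczSobolev.IsModularlyContinuous (OrliczSobolev.W1 A Ω)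
        (OrliczSobolev.W1ModularTendsto A Ω) (OrliczSobolev.compOp f)) ∧
    (f 0 = 0 →
      Bornology.IsBounded Ω ∨ OrliczSobolev.EquivNearZero A (fun t => (t : ℝ≥0∞)) →
      OrliczSobolev.IsModularlyContinuous (OrliczSobolev.V10 A Ω)
        (OrliczSobolev.V10ModularTendsto A Ω) (OrliczSobolev.compOp f)) :=
  ⟨OrliczSobolev.isModularlyContinuous_compOp_W1 hA hA_nondeg hΩ_open hΩ_interval hf,
    OrliczSobolev.isModularlyContinuous_compOp_V10 hA hA_nondeg hΩ_open hf⟩
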